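/- Let $X:U\to\mathbb{R}^3$ be a $C^\infty$ map on an open set $U\subset\mathbb{R}^2$ with coordinates $(u,v)$. Put $L=|X_u,X_v,X_{uu}|$, $M=|X_u,X_v,X_{uv}|$, $N=|X_u,X_v,X_{vv}|$ and $D=LN-M^2$; the parabolic set is $\{D=0\}$. Where $D\neq0$ let $\nu=|D|^{-1/4}X_u\times X_v$ be the affine conormal, let $\xi$ be the affine normal, i.e. the vector field with $\langle\nu,\xi\rangle=1$, $\langle\nu_u,\xi\rangle=\langle\nu_v,\xi\rangle=0$, and let $l=\langle\nu_u,\xi_u\rangle$, $m=\langle\nu_u,\xi_v\rangle$, $n=\langle\nu_v,\xi_v\rangle$. A vector $w\neq0$ is an affine principal direction at a point with $D\ne0$ if $d\xi(w)+\lambda\,dX(w)=0$ for some $\lambda\in\mathbb{R}$; equivalently, $w=(du,dv)$ satisfies $$(lM-mL)\,du^2+(lN-nL)\,du\,dv+(mN-nM)\,dv^2=0 .$$ At a point with $D=0$, a vector $w=(du,dv)\neq 0$ is an affine principal direction if it is a zero of the numerator of this equation, that is, of the continuous extension to that point of $D^2$ times its left-hand side. Affine principal lines are the integral curves (regular $C^1$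 curves) of the affine principal directions. The affine configuration consists of these curves together with its singular set: the parabolic set and the points that do not have two transversal affine principal directions. Let $p\in U$ be an ordinary parabolic point: $X$ is an immersion at $p$, $D(p)=0$, and $dD_p(w)\neq0$ for some vector $w=(w_1,w_2)$ with $Lw_1^2+2Mw_1w_2+Nw_2^2=0$ at $p$ (so near $p$ the parabolic set is a regular curve, and it is transversal to the double asymptotic direction). Then: 1. Near $p$ there are two smooth families of affine principal lines, and they are transversal: on some neighbourhood $V$ of $p$ there are $C^\infty$ vector fields $e,f$, linearly independent at every point, such that the affine principal directions at each $q\in V$ are exactly the nonzero multiples of $e(q)$ and of $f(q)$. 2. The affine configuration at $p$ is locally topologically equivalent to the normal form $v\,du\,dv=0$ at the origin: there is a germ of homeomorphism at $p$, sending $p$ to $0$, that takes the affine principal lines exactly to the integral curves of $v\,du\,dv=0$ and the singular set to $\{v=0\}$. 3. The affine configuration is determined, up to local topological equivalence, by the 4-jet of the surface: if $Y$ is any $C^\infty$ map from a neighbourhood of $p$ to $\mathbb{R}^3$ with the same 4-jet at $p$ as $X$, then the affine configurations of $X$ and $Y$ at $p$ are locally topologically equivalent, by a germ of homeomorphism fixing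 $p$ that takes affine principal lines exactly to affine principal lines and singular set to singular set. -/

import Mathlib

open scoped ContDiff

noncomputable section

namespace AffSurf

/-- The parameter plane, with coordinates `(u, v)`. -/
abbrev Plane : Type := ℝ × ℝ

/-- The ambient space `ℝ³`. -/
abbrev Space : Type := Fin 3 → ℝ

/-- Partial derivative `∂f/∂u`. -/
def partialU (f : Plane → Space) (q : Plane) : Space := fderiv ℝ f q (1, 0)

/-- Partial derivative `∂f/∂v`. -/
def partialV (f : Plane → Space) (q : Plane) : Space := fderiv ℝ f q (0, 1)

/-- The determinant `|a, b, c|` of three vectors of `ℝ³`. -/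
def det3 (a b c : Space) : ℝ := Matrix.det (Matrix.of ![a, b, c])

/-- `L = |X_u, X_v, X_uu|`. -/
def coeffL (X : Plane → Space) (q : Plane) : ℝ :=
  det3 (partialU X q) (partialV X q) (partialU (partialU X) q)

/-- `M = |X_u, X_v, X_uv|`. -/
def coeffM (X : Plane → Space) (q : Plane) : ℝ :=
  det3 (partialU X q) (partialV X q) (partialV (partialU X) q)

/-- `N = |X_u, X_v, X_vv|`. -/
def coeffN (X : Plane → Space) (q : Plane) : ℝ :=
  det3 (partialU X q) (partialV X q) (partialV (partialV X) q)

/-- `LN - M²`; on a regular surface the parabolic set (`K_e = 0`) is its zero set. -/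
def hessDet (X : Plane → Space) (q : Plane) : ℝ :=
  coeffL X q * coeffN X q - coeffM X q ^ 2

/-- The affine conormal `ν = |LN - M²|^(-1/4) (X_u × X_v)` (meaningful off the parabolic set). -/
def conormal (X : Plane → Space) (q : Plane) : Space :=
  |hessDet X q| ^ (-(1 / 4) : ℝ) • crossProduct (partialU X q) (partialV X q)

/-- The affine (Blaschke) normal `ξ` (meaningful off the parabolic set): the vector determined by
`⟨ν, ξ⟩ = 1` and `⟨ν_u, ξ⟩ = ⟨ν_v, ξ⟩ = 0` (equivalently `⟨ν, ξ⟩ = 1`, `⟨ν, ξ_u⟩ = ⟨ν, ξ_v⟩ = 0`),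
that is `ξ = (ν_u × ν_v) / |ν, ν_u, ν_v|`. -/
def affineNormal (X : Plane → Space) (q : Plane) : Space :=
  (det3 (conormal X q) (partialU (conormal X) q) (partialV (conormal X) q))⁻¹ •
    crossProduct (partialU (conormal X) q) (partialV (conormal X) q)

/-- Coefficient `l = ⟨ν_u, ξ_u⟩` of the affine third fundamental form. -/
def thirdL (X : Plane → Space) (q : Plane) : ℝ :=
  dotProduct (partialU (conormal X) q) (partialU (affineNormal X) q)

/-- Coefficient `m = ⟨ν_u, ξ_v⟩` of the affine third fundamental form. -/
def thirdM (X : Plane → Space) (q : Plane) : ℝ :=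
  dotProduct (partialU (conormal X) q) (partialV (affineNormal X) q)

/-- Coefficient `n = ⟨ν_v, ξ_v⟩` of the affine third fundamental form. -/
def thirdN (X : Plane → Space) (q : Plane) : ℝ :=
  dotProduct (partialV (conormal X) q) (partialV (affineNormal X) q)

/-- The quadratic form `(lM - mL) du² + (lN - nL) du dv + (mN - nM) dv²` of the equation of affine
curvature lines, at `q` and `w = (du, dv)`. -/
def curvatureLineForm (X : Plane → Space) (q w : Plane) : ℝ :=
  (thirdL X q * coeffM X q - thirdM X q * coeffL X q) * w.1 ^ 2 +
    (thirdL X q * coeffN X q - thirdN X q * coeffL X q) * (w.1 * w.2) +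
    (thirdM X q * coeffN X q - thirdN X q * coeffM X q) * w.2 ^ 2

/-- `w ≠ 0` is an affine principal direction at the parameter value `q`.  Off the parabolic set:
`dX(w)` is an eigenvector of the affine shape operator, `dξ(w) + λ dX(w) = 0` for some real `λ`.
On the parabolic set: `w` is a zero of the numerator of the equation of affine curvature lines.
The coefficients of that equation have denominator `(LN - M²)²`, so the numerator at a parabolic
point is the limit of `(LN - M²)²` times the form, taken through non-parabolic points. -/
def IsAffinePrincipalDirection (X : Plane → Space) (q w : Plane) : Prop :=
  w ≠ 0 ∧
    ((hessDet X q ≠ 0 ∧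
        ∃ lam : ℝ, fderiv ℝ (affineNormal X) q w + lam • fderiv ℝ X q w = 0) ∨
      (hessDet X q = 0 ∧
        Filter.Tendsto (fun q' => hessDet X q' ^ 2 * curvatureLineForm X q' w)
          (nhdsWithin q {q' | hessDet X q' ≠ 0}) (nhds 0)))

/-- An ordinary parabolic point of a parametrized surface: `X` is an immersion at `p`, `p` is
parabolic, and the (double) asymptotic direction `w` at `p` is transversal to the parabolic set,
which is a regular curve `LN - M² = 0` there. -/
def IsOrdinaryParabolicPoint (X : Plane → Space) (p : Plane) : Prop :=
  LinearIndependent ℝ ![partialU X p, partialV X p] ∧ hessDet X p = 0 ∧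
    ∃ w : Plane,
      coeffL X p * w.1 ^ 2 + 2 * coeffM X p * (w.1 * w.2) + coeffN X p * w.2 ^ 2 = 0 ∧
      fderiv ℝ (hessDet X) p w ≠ 0

/-- A configuration of curves in the plane: the directions allowed at each point, and the
singular set. -/
structure Configuration where
  /-- `dir q w`: the vector `w` is an allowed direction at `q`. -/
  dir : Plane → Plane → Prop
  /-- The singular set. -/
  sing : Set Plane

/-- The directions `dir` at `q` form exactly the two transversal lines spanned by `e` and `f`. -/
def IsTransversalPair (dir : Plane → Plane → Prop) (q e f : Plane) : Prop :=
  LinearIndependent ℝ ![e, f] ∧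
    ∀ w : Plane, w ≠ 0 → (dir q w ↔ (∃ c : ℝ, w = c • e) ∨ (∃ c : ℝ, w = c • f))

/-- The affine configuration of the parametrized surface `X`, in the parameter plane: the affine
principal directions, and as singular set the parabolic set together with all points that do not
have two transversal affine principal directions (umbilics, double or non-real directions). -/
def affineConfiguration (X : Plane → Space) : Configuration where
  dir := IsAffinePrincipalDirection X
  sing := {q | hessDet X q = 0 ∨
    ¬ ∃ e f : Plane, IsTransversalPair (IsAffinePrincipalDirection X) q e f}

/-- The configuration of the binary differential equation `a du² + b du dv + c dv² = 0`; its
singular set consists of the points where it does not have two distinct solution directions. -/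
def bdeConfiguration (a b c : Plane → ℝ) : Configuration where
  dir q w := a q * w.1 ^ 2 + b q * (w.1 * w.2) + c q * w.2 ^ 2 = 0
  sing := {q | b q ^ 2 - 4 * a q * c q ≤ 0}

/-- The set `C` is (the trace of) an integral curve: the image of an open interval under a regular
`C¹` curve that is everywhere tangent to an allowed direction. -/
def Configuration.IsIntegralArc (F : Configuration) (C : Set Plane) : Prop :=
  ∃ (a b : ℝ) (γ : ℝ → Plane), a < b ∧ ContDiffOn ℝ 1 γ (Set.Ioo a b) ∧
    C = γ '' Set.Ioo a b ∧
    ∀ t ∈ Set.Ioo a b, deriv γ t ≠ 0 ∧ F.dir (γ t) (deriv γ t)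

/-- Local topological equivalence of `F` at `p` and `G` at `p'`: a germ of homeomorphism taking
`p` to `p'`, integral curves exactly to integral curves, and the singular set to the
singular set. -/
def LocallyTopEquivalent (F : Configuration) (p : Plane) (G : Configuration) (p' : Plane) : Prop :=
  ∃ φ : OpenPartialHomeomorph Plane Plane, p ∈ φ.source ∧ φ p = p' ∧
    (∀ C : Set Plane, C ⊆ φ.source → (F.IsIntegralArc C ↔ G.IsIntegralArc (φ '' C))) ∧
    ∀ q ∈ φ.source, q ∈ F.sing ↔ φ q ∈ G.sing

/-- The binary differential equation `v du dv = 0`. -/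
def normalForm : Configuration := bdeConfiguration (fun _ => 0) (fun q => q.2) (fun _ => 0)

/-- `X` and `Y` have the same `k`-jet at `p`. -/
def SameJet (k : ℕ) (X Y : Plane → Space) (p : Plane) : Prop :=
  ∀ i ≤ k, iteratedFDeriv ℝ i X p = iteratedFDeriv ℝ i Y p

end AffSurf

end

/-! Write `D = LN - M²`. Near `p` choose a constant vector `k` transversal to the surface and expand
the affine normal in the frame `X_u, X_v, k`. The condition `⟨ν, ξ⟩ = 1` forces the `k`-coefficient
to be `|D|^(1/4) / ρ` with `ρ = |X_u, X_v, k|`. Tangency of `dξ` then forces the tangential part to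
be `|D|^(1/4) D⁻² Z` for a field `Z` that is smooth across the parabolic set. Differentiating gives
`dξ = |D|^(1/4) D⁻³ dX ∘ A`, where `A(w) = D K(w) - (7/4) dD(w) Z` is again smooth. Up to sign, the
numerator of the equation of affine curvature lines is `det (A w, w)`, so on both sides of the
parabolic set, and on it, principal directions are eigendirections of `A`
(`hessDet_sq_mul_curvatureLineForm`, `isAffinePrincipalDirection_iff`).

At `p` the map `A` has rank one, with eigenvalues `0` and `μ = -(7/4) dD(Z)`. Here `dD(Z)` is, up to
a nonzero factor, the adjugate of the second form evaluated at `dD`. It is nonzero exactly because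
the asymptotic direction is transversal to the parabolic set. The eigenvalues are therefore simple
and there are smooth eigenfields `e` (for `μ`) and `f` (for `0`). Applying `dD` to `A f = l₀ f`
yields `dD(f) = κ D`, so the parabolic set is invariant under `f`, while `e` crosses it
(`exists_eigenfields_pencil`, `exists_principal_frame`).

A first integral `h` of `e` and a first integral `g` of `f` are local coordinates in which the
principal lines are the coordinate lines, and a Grönwall argument identifies `D = 0` with `g = 0`
(`locallyTopEquivalent_normalForm`). The factor `v` in `v du dv = 0` creates no new regular `C¹`
integral curves. Finally, being an ordinary parabolic point depends only on a finite jet, so `X` and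
`Y` share the same normal form. -/

noncomputable section

namespace AffSurf

open Set Filter Topology

/-! ### First integrals of planar `C¹` vector fields -/

/-- The average of `∂s/∂v` over the vertical segment from `(u, y)` to `(u, y')`. -/
def verticalSlope (s : Plane → ℝ) (u y y' : ℝ) : ℝ :=
  ∫ θ in (0 : ℝ)..1, fderiv ℝ s (u, y + θ * (y' - y)) (0, 1)

theorem continuous_verticalSlope {s : Plane → ℝ} (hs : ContDiff ℝ 1 s) :
    Continuous fun x : ℝ × ℝ × ℝ => verticalSlope s x.1 x.2.1 x.2.2 := by
  have h := hs.continuous_fderiv one_ne_zero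
  unfold verticalSlope
  apply intervalIntegral.continuous_parametric_intervalIntegral_of_continuous'
  fun_prop

theorem sub_eq_verticalSlope {s : Plane → ℝ} (hs : ContDiff ℝ 1 s) (u y y' : ℝ) :
    s (u, y') - s (u, y) = verticalSlope s u y y' * (y' - y) := by
  have h := hs.continuous_fderiv one_ne_zero
  have hd := hs.differentiable one_ne_zero
  have key : ∀ θ : ℝ, HasDerivAt (fun θ : ℝ => s (u, y + θ * (y' - y)))
      (fderiv ℝ s (u, y + θ * (y' - y)) (0, 1) * (y' - y)) θ := by
    intro θ
    have h1 : HasDerivAt (fun θ : ℝ => ((u, y + θ * (y' - y)) : Plane)) (0, 1 * (y' - y)) θ :=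
      (hasDerivAt_const θ u).prodMk (((hasDerivAt_id θ).mul_const (y' - y)).const_add y)
    have h2 := (hd (u, y + θ * (y' - y))).hasFDerivAt.comp_hasDerivAt θ h1
    convert! h2 using 1
    rw [show ((0, 1 * (y' - y)) : Plane) = (y' - y) • (0, 1) by simp, map_smul, smul_eq_mul,
      mul_comm]
  have hint := intervalIntegral.integral_eq_sub_of_hasDerivAt (a := 0) (b := 1)
    (fun θ _ => key θ) (by apply Continuous.intervalIntegrable; fun_prop)
  rw [intervalIntegral.integral_mul_const] at hint
  rw [verticalSlope, hint]
  simp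

/-- Compact support makes the slope bounded and globally Lipschitz, so a single Picard–Lindelöf
solution family covers the whole square. -/
theorem exists_continuous_slopeFlow {s : Plane → ℝ} (hs : ContDiff ℝ 1 s)
    (hc : HasCompactSupport s) :
    ∃ Y : Plane → ℝ, Continuous Y ∧ (∀ b ∈ Icc (-1 : ℝ) 1, Y (0, b) = b) ∧
      ∀ u ∈ Ioo (-1 : ℝ) 1, ∀ b ∈ Icc (-1 : ℝ) 1,
        HasDerivAt (fun t => Y (t, b)) (s (u, Y (u, b))) u := by
  obtain ⟨K, hK⟩ := hs.lipschitzWith_of_hasCompactSupport hc one_ne_zero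
  obtain ⟨C, hC⟩ := hc.exists_bound_of_continuous hs.continuous
  set L : NNReal := C.toNNReal
  have hL : ∀ q, ‖s q‖ ≤ L := fun q => (hC q).trans (Real.le_coe_toNNReal C)
  -- Initial values lie within `1` of `0` and times within `1` of `0`. With speed at most `L`,
  -- solutions stay within `L + 1`.
  have hPL : IsPicardLindelof (fun t y => s (t, y)) (tmin := -1) (tmax := 1)
      ⟨0, by norm_num⟩ 0 (L + 1) 1 L K :=
    { lipschitzOnWith := fun t _ => by
        have h1 : LipschitzWith 1 (fun y : ℝ => ((t, y) : Plane)) :=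
          LipschitzWith.prodMk_left t
        have := hK.comp h1
        rw [mul_one] at this
        exact this.lipschitzOnWith
      continuousOn := fun x _ => by
        have := hs.continuous
        fun_prop
      norm_le := fun t _ x _ => hL _
      mul_max_le := by norm_num }
  obtain ⟨α, hα, hcont⟩ := hPL.exists_forall_mem_closedBall_eq_hasDerivWithinAt_continuousOn
  have h11 : (-1 : ℝ) ≤ 1 := by norm_num
  -- Clamping both arguments to `[-1, 1]` gives continuity on the whole plane and changes nothing on
  -- the square.
  refine ⟨fun q => α (projIcc (-1) 1 h11 q.2, projIcc (-1) 1 h11 q.1), ?_, ?_, ?_⟩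
  · rw [continuousOn_iff_continuous_domRestrict] at hcont
    have : Continuous fun q : Plane =>
        ((projIcc (-1) 1 h11 q.2 : ℝ), (projIcc (-1) 1 h11 q.1 : ℝ)) := by fun_prop
    have h2 := hcont.comp (this.subtype_mk (fun q => ⟨by
      rw [Real.closedBall_eq_Icc]; simp, (projIcc (-1) 1 h11 q.1).2⟩))
    exact h2
  · intro b hb
    have h0 : (0 : ℝ) ∈ Icc (-1 : ℝ) 1 := by norm_num
    have := (hα b (by rw [Real.closedBall_eq_Icc]; simpa using hb)).1
    simpa [projIcc_of_mem h11 hb, projIcc_of_mem h11 h0] using this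
  · intro u hu b hb
    have hu' := Ioo_subset_Icc_self hu
    have := (hα b (by rw [Real.closedBall_eq_Icc]; simpa using hb)).2 u hu'
    have h2 := this.hasDerivAt (Icc_mem_nhds hu.1 hu.2)
    simp only [projIcc_of_mem h11 hb, projIcc_of_mem h11 hu']
    refine h2.congr_of_eventuallyEq ?_
    filter_upwards [Icc_mem_nhds hu.1 hu.2] with t ht
    simp [projIcc_of_mem h11 ht]

/-- The exact difference formula for solutions of `y' = s (u, y)`. -/
theorem slopeFlow_sub {s Y : Plane → ℝ} (hs : ContDiff ℝ 1 s) (hY : Continuous Y)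
    (hY0 : ∀ b ∈ Icc (-1 : ℝ) 1, Y (0, b) = b)
    (hYd : ∀ u ∈ Ioo (-1 : ℝ) 1, ∀ b ∈ Icc (-1 : ℝ) 1,
      HasDerivAt (fun t => Y (t, b)) (s (u, Y (u, b))) u)
    {u b b' : ℝ} (hu : u ∈ Ioo (-1 : ℝ) 1) (hb : b ∈ Icc (-1 : ℝ) 1) (hb' : b' ∈ Icc (-1 : ℝ) 1) :
    Y (u, b') - Y (u, b) =
      (b' - b) * Real.exp (∫ t in (0 : ℝ)..u, verticalSlope s t (Y (t, b)) (Y (t, b'))) := by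
  set c : ℝ → ℝ := fun t => verticalSlope s t (Y (t, b)) (Y (t, b')) with hcdef
  have hc : Continuous c := by
    have := continuous_verticalSlope hs
    exact this.comp (by fun_prop : Continuous fun t => (t, Y (t, b), Y (t, b')))
  -- The difference of two solutions satisfies the linear equation `δ' = c δ`. Dividing by its
  -- integrating factor gives a constant.
  set G : ℝ → ℝ := fun t => (Y (t, b') - Y (t, b)) * Real.exp (-∫ x in (0 : ℝ)..t, c x) with hG
  have hGd : ∀ t ∈ Ioo (-1 : ℝ) 1, HasDerivAt G 0 t := by
    intro t ht
    have h1 := ((hYd t ht b' hb').sub (hYd t ht b hb)).mul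
      ((hc.integral_hasStrictDerivAt 0 t).hasDerivAt.neg.exp)
    convert! h1 using 1
    rw [sub_eq_verticalSlope hs]
    simp only [hcdef, Pi.sub_apply]
    ring
  have h0 : (0 : ℝ) ∈ Ioo (-1 : ℝ) 1 := by norm_num
  have hconst : G u = G 0 :=
    isOpen_Ioo.is_const_of_deriv_eq_zero isPreconnected_Ioo
      (fun t ht => (hGd t ht).differentiableAt.differentiableWithinAt)
      (fun t ht => (hGd t ht).deriv) hu h0
  simp only [hG, intervalIntegral.integral_same, neg_zero, Real.exp_zero, mul_one, hY0 b hb,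
    hY0 b' hb'] at hconst
  rw [← hconst, mul_assoc, ← Real.exp_add]
  simp

theorem hasDerivAt_of_sub_eq_mul {f E : ℝ → ℝ} {b : ℝ}
    (h : ∀ᶠ b' in 𝓝 b, f b' - f b = (b' - b) * E b') (hE : ContinuousAt E b) :
    HasDerivAt f (E b) b := by
  rw [hasDerivAt_iff_tendsto_slope]
  refine (hE.tendsto.mono_left nhdsWithin_le_nhds).congr' ?_
  filter_upwards [h.filter_mono nhdsWithin_le_nhds, self_mem_nhdsWithin] with x hx hne
  have : x - b ≠ 0 := sub_ne_zero.mpr hne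
  rw [slope_def_field, hx]
  field_simp

/-- The exact difference formula replaces the variational equation: its exponential factor is
jointly continuous in the initial values, so its diagonal value is a continuous derivative in the
initial value. Two continuous partial derivatives then give `C¹`. -/
theorem exists_C1_slopeFlow {s : Plane → ℝ} (hs : ContDiff ℝ 1 s) (hc : HasCompactSupport s) :
    ∃ Y : Plane → ℝ, ContDiffAt ℝ 1 Y 0 ∧ Y 0 = 0 ∧ fderiv ℝ Y 0 (0, 1) = 1 ∧
      ∀ᶠ q in 𝓝 (0 : Plane), fderiv ℝ Y q (1, 0) = s (q.1, Y q) := by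
  obtain ⟨Y, hY, hY0, hYd⟩ := exists_continuous_slopeFlow hs hc
  set E : Plane → ℝ → ℝ := fun q b' =>
    Real.exp (∫ t in (0 : ℝ)..q.1, verticalSlope s t (Y (t, q.2)) (Y (t, b'))) with hEdef
  have hE : Continuous fun x : Plane × ℝ => E x.1 x.2 := by
    refine Real.continuous_exp.comp ?_
    refine intervalIntegral.continuous_parametric_intervalIntegral_of_continuous
      (f := fun (x : Plane × ℝ) t => verticalSlope s t (Y (t, x.1.2)) (Y (t, x.2))) ?_ (by fun_prop)
    exact (continuous_verticalSlope hs).comp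
      (by fun_prop : Continuous fun x : (Plane × ℝ) × ℝ => (x.2, Y (x.2, x.1.1.2), Y (x.2, x.1.2)))
  have hsc := hs.continuous
  set S : Set Plane := Ioo (-1 : ℝ) 1 ×ˢ Ioo (-1 : ℝ) 1
  have hS : IsOpen S := isOpen_Ioo.prod isOpen_Ioo
  have h0S : (0 : Plane) ∈ S := by constructor <;> norm_num
  have hdu : ∀ q ∈ S, HasDerivAt (fun t => Y (t, q.2)) (s (q.1, Y q)) q.1 :=
    fun q hq => hYd q.1 hq.1 q.2 (Ioo_subset_Icc_self hq.2)
  have hdv : ∀ q ∈ S, HasDerivAt (fun t => Y (q.1, t)) (E q q.2) q.2 := by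
    intro q hq
    refine hasDerivAt_of_sub_eq_mul ?_ (by fun_prop)
    filter_upwards [Icc_mem_nhds hq.2.1 hq.2.2] with b' hb'
    exact slopeFlow_sub hs hY hY0 hYd hq.1 (Ioo_subset_Icc_self hq.2) hb'
  set F₁ : Plane → ℝ →L[ℝ] ℝ := fun q => (s (q.1, Y q)) • ContinuousLinearMap.id ℝ ℝ with hF₁
  set F₂ : Plane → ℝ →L[ℝ] ℝ := fun q => (E q q.2) • ContinuousLinearMap.id ℝ ℝ with hF₂
  have hF₁c : Continuous F₁ := by fun_prop
  have hF₂c : Continuous F₂ := by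
    have : Continuous fun q : Plane => E q q.2 :=
      hE.comp (by fun_prop : Continuous fun q : Plane => (q, q.2))
    fun_prop
  have hF : ∀ q ∈ S, HasFDerivAt Y ((F₁ q).coprod (F₂ q)) q := by
    intro q hq
    have := hasStrictFDerivAt_uncurry_coprod (𝕜 := ℝ) (u := q) (f := fun u v => Y (u, v))
      (f₁ := fun u v => F₁ (u, v)) (f₂ := fun u v => F₂ (u, v)) ?_ ?_ ?_ ?_
    · exact this.hasFDerivAt
    · filter_upwards [hS.mem_nhds hq] with v hv
      rw [hasFDerivAt_iff_hasDerivAt]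
      simpa [hF₁, Function.HasUncurry.uncurry] using hdu v hv
    · filter_upwards [hS.mem_nhds hq] with v hv
      rw [hasFDerivAt_iff_hasDerivAt]
      simpa [hF₂, Function.HasUncurry.uncurry] using hdv v hv
    · exact hF₁c.continuousAt
    · exact hF₂c.continuousAt
  refine ⟨Y, ?_, hY0 0 (by norm_num), ?_, ?_⟩
  · rw [contDiffAt_one_iff]
    exact ⟨fun q => (F₁ q).coprod (F₂ q), S, hS.mem_nhds h0S, by fun_prop, hF⟩
  · rw [(hF 0 h0S).fderiv]
    simp [hF₂, hEdef]
  · filter_upwards [hS.mem_nhds h0S] with q hq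
    rw [(hF q hq).fderiv]
    simp [hF₁]

theorem exists_compactSupport_eventuallyEq {s : Plane → ℝ} {p : Plane} (hs : ContDiffAt ℝ 1 s p) :
    ∃ s' : Plane → ℝ, ContDiff ℝ 1 s' ∧ HasCompactSupport s' ∧ s' =ᶠ[𝓝 p] s := by
  have hev : ∀ᶠ q in 𝓝 p, ContDiffAt ℝ 1 s q := hs.eventually (by simp)
  obtain ⟨r, hr, hball⟩ := Metric.eventually_nhds_iff_ball.mp hev
  let χ : ContDiffBump p := ⟨r / 4, r / 2, by positivity, by linarith⟩
  refine ⟨fun q => χ q * s q, ?_, ?_, ?_⟩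
  · rw [← contMDiff_iff_contDiff]
    refine contMDiff_of_tsupport fun q hq => ContDiffAt.contMDiffAt ?_
    have hq' : q ∈ tsupport χ := tsupport_mul_subset_left hq
    rw [χ.tsupport_eq] at hq'
    exact χ.contDiffAt.mul (hball q (Metric.closedBall_subset_ball (by simp [χ, hr]) hq'))
  · exact χ.hasCompactSupport.mul_right
  · filter_upwards [χ.eventuallyEq_one] with q hq
    simp [hq]

/-- The first integral is the initial value of the solution through a point, that is, the second
component of the local inverse of `(u, b) ↦ (u, Y (u, b))`. -/
theorem exists_firstIntegral_of_slope {s : Plane → ℝ} (hs : ContDiffAt ℝ 1 s 0) :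
    ∃ g : Plane → ℝ, ContDiffAt ℝ 1 g 0 ∧ g 0 = 0 ∧ fderiv ℝ g 0 (0, 1) = 1 ∧
      ∀ᶠ q in 𝓝 (0 : Plane), fderiv ℝ g q (1, s q) = 0 := by
  obtain ⟨s', hs', hc, hss'⟩ := exists_compactSupport_eventuallyEq hs
  obtain ⟨Y, hY, hY0, hYv, hYu⟩ := exists_C1_slopeFlow hs' hc
  set Φ : Plane → Plane := fun q => (q.1, Y q) with hΦdef
  have hΦ : ContDiffAt ℝ 1 Φ 0 := contDiffAt_fst.prodMk hY
  have hΦd : ∀ q, DifferentiableAt ℝ Y q →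
      HasFDerivAt Φ ((ContinuousLinearMap.fst ℝ ℝ ℝ).prod (fderiv ℝ Y q)) q :=
    fun q hq => hasFDerivAt_fst.prodMk hq.hasFDerivAt
  have hlin : ∀ (q w : Plane), fderiv ℝ Y q w
      = w.1 * fderiv ℝ Y q (1, 0) + w.2 * fderiv ℝ Y q (0, 1) := by
    intro q w
    conv_lhs => rw [show w = w.1 • ((1, 0) : Plane) + w.2 • ((0, 1) : Plane) by ext <;> simp]
    simp only [map_add, map_smul, smul_eq_mul]
  -- Since `∂Y/∂b = 1` at the origin, the derivative of `Φ` there is a shear.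
  let T : Plane ≃L[ℝ] Plane := ContinuousLinearEquiv.skewProd (ContinuousLinearEquiv.refl ℝ ℝ)
    (ContinuousLinearEquiv.refl ℝ ℝ) (fderiv ℝ Y 0 (1, 0) • ContinuousLinearMap.id ℝ ℝ)
  have hT : HasFDerivAt Φ (T : Plane →L[ℝ] Plane) 0 := by
    convert! hΦd 0 (hY.differentiableAt one_ne_zero) using 1
    apply ContinuousLinearMap.ext
    intro w
    ext
    · simp [T]
    · rw [ContinuousLinearMap.prod_apply, hlin 0 w, hYv]
      simp [T]
      ring
  have hΦ0 : Φ 0 = 0 := by ext <;> simp [hΦdef, hY0]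
  let e := hΦ.toOpenPartialHomeomorph Φ hT one_ne_zero
  have h0e : (0 : Plane) ∈ e.source := hΦ.mem_toOpenPartialHomeomorph_source hT one_ne_zero
  have hecoe : (e : Plane → Plane) = Φ := rfl
  have hsymm : ContDiffAt ℝ 1 e.symm 0 := by
    have := hΦ.to_localInverse hT one_ne_zero
    rw [hΦ0] at this
    exact this
  set g : Plane → ℝ := fun q => (e.symm q).2 with hgdef
  have hg : ContDiffAt ℝ 1 g 0 := hsymm.snd
  have hgΦ : ∀ q ∈ e.source, g (Φ q) = q.2 := fun q hq => by
    simp only [hgdef, ← hecoe, e.left_inv hq]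
  have hg_ev : ∀ᶠ q in 𝓝 (0 : Plane), ContDiffAt ℝ 1 g q := hg.eventually (by simp)
  have hY_ev : ∀ᶠ q in 𝓝 (0 : Plane), ContDiffAt ℝ 1 Y q := hY.eventually (by simp)
  -- The chain rule applied to `g (Φ q) = q.2`. Along `(1, 0)` it says that `g` is constant on
  -- solution curves.
  have hcomp : ∀ q ∈ e.source, DifferentiableAt ℝ g (Φ q) → DifferentiableAt ℝ Y q → ∀ w,
      fderiv ℝ g (Φ q) (w.1, fderiv ℝ Y q w) = w.2 := by
    intro q hq h1 h2 w
    have h3 := h1.hasFDerivAt.comp q (hΦd q h2)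
    have h4 : HasFDerivAt (g ∘ Φ) (ContinuousLinearMap.snd ℝ ℝ ℝ) q := by
      refine hasFDerivAt_snd.congr_of_eventuallyEq ?_
      filter_upwards [e.open_source.mem_nhds hq] with x hx using hgΦ x hx
    simpa using DFunLike.congr_fun (h3.unique h4) w
  refine ⟨g, hg, ?_, ?_, ?_⟩
  · simpa [hΦ0] using hgΦ 0 h0e
  · have := hcomp 0 h0e (by rw [hΦ0]; exact hg.differentiableAt one_ne_zero)
      (hY.differentiableAt one_ne_zero) (0, 1)
    simpa [hΦ0, hYv] using this
  · have hsc : Tendsto e.symm (𝓝 0) (𝓝 0) := by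
      have h5 := hsymm.continuousAt.tendsto
      have h6 : e.symm 0 = 0 := by
        have := e.left_inv h0e
        rwa [hecoe, hΦ0] at this
      rwa [h6] at h5
    have htgt : ∀ᶠ q in 𝓝 (0 : Plane), q ∈ e.target := by
      apply e.open_target.mem_nhds
      have := e.map_source h0e
      rwa [hecoe, hΦ0] at this
    filter_upwards [hg_ev, hsc.eventually hY_ev, hsc.eventually hYu, htgt, hss']
      with q hq1 hq2 hq3 hq4 hq5
    have hq6 : Φ (e.symm q) = q := e.right_inv hq4
    have := hcomp (e.symm q) (e.map_target hq4) (by rw [hq6]; exact hq1.differentiableAt one_ne_zero)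
      (hq2.differentiableAt one_ne_zero) (1, 0)
    rw [hq3] at this
    change fderiv ℝ g (Φ (e.symm q)) (1, s' (Φ (e.symm q))) = 0 at this
    rwa [hq6, hq5] at this

theorem exists_firstIntegral_of_fst_ne_zero {f : Plane → Plane} {p : Plane}
    (hf : ContDiffAt ℝ 1 f p) (h : (f p).1 ≠ 0) :
    ∃ g : Plane → ℝ, ContDiffAt ℝ 1 g p ∧ g p = 0 ∧ fderiv ℝ g p ≠ 0 ∧
      ∀ᶠ q in 𝓝 p, fderiv ℝ g q (f q) = 0 := by
  have hs : ContDiffAt ℝ 1 (fun q => (f (q + p)).2 / (f (q + p)).1) (0 : Plane) := by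
    have h1 : ContDiffAt ℝ 1 (fun q => f (q + p)) (0 : Plane) :=
      ContDiffAt.comp (0 : Plane) (by simpa using hf) (contDiffAt_id.add contDiffAt_const)
    exact h1.snd.div h1.fst (by simpa using h)
  obtain ⟨g, hg, hg0, hgv, hgs⟩ := exists_firstIntegral_of_slope hs
  have hsub : Tendsto (fun q => q - p) (𝓝 p) (𝓝 0) := by
    have : ContinuousAt (fun q => q - p) p := by fun_prop
    simpa [ContinuousAt] using this
  refine ⟨fun q => g (q - p), ?_, by simpa using hg0, ?_, ?_⟩
  · exact ContDiffAt.comp p (by simpa using hg) (contDiffAt_id.sub contDiffAt_const)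
  · intro h0
    rw [fderiv_comp_sub, sub_self] at h0
    rw [h0] at hgv
    simp at hgv
  · filter_upwards [hsub.eventually hgs, hf.fst.continuousAt.eventually_ne h] with q hq hq1
    rw [fderiv_comp_sub]
    replace hq : fderiv ℝ g (q - p) (1, (f q).2 / (f q).1) = 0 := by simpa using hq
    have : f q = (f q).1 • ((1, (f q).2 / (f q).1) : Plane) := by
      ext
      · simp
      · simp; field_simp
    rw [this, map_smul, hq, smul_zero]

theorem exists_firstIntegral {f : Plane → Plane} {p : Plane}
    (hf : ContDiffAt ℝ 1 f p) (h : f p ≠ 0) :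
    ∃ g : Plane → ℝ, ContDiffAt ℝ 1 g p ∧ g p = 0 ∧ fderiv ℝ g p ≠ 0 ∧
      ∀ᶠ q in 𝓝 p, fderiv ℝ g q (f q) = 0 := by
  by_cases h1 : (f p).1 = 0
  · have h2 : (f p).2 ≠ 0 := fun h2 => h (Prod.ext h1 h2)
    let T : Plane ≃L[ℝ] Plane := ContinuousLinearEquiv.prodComm ℝ ℝ ℝ
    have hTT : ∀ q, T (T q) = q := fun q => by simp [T]
    obtain ⟨g, hg, hg0, hgd, hgs⟩ := exists_firstIntegral_of_fst_ne_zero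
      (f := fun q => T (f (T q))) (p := T p)
      (T.contDiff.contDiffAt.comp (T p)
        (ContDiffAt.comp (T p) (by rwa [hTT]) T.contDiff.contDiffAt)) (by rw [hTT]; simpa [T])
    refine ⟨g ∘ T, hg.comp p T.contDiff.contDiffAt, hg0, ?_, ?_⟩
    · rw [ContinuousLinearEquiv.comp_right_fderiv]
      intro h0
      apply hgd
      apply ContinuousLinearMap.ext
      intro w
      have := DFunLike.congr_fun h0 (T w)
      simpa [hTT] using this
    · filter_upwards [T.continuous.continuousAt.eventually hgs] with q hq
      rw [ContinuousLinearEquiv.comp_right_fderiv]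
      simpa [hTT] using hq
  · exact exists_firstIntegral_of_fst_ne_zero hf h1

/-! ### Straightening two transversal foliations and an invariant curve -/

/-- Grönwall along the horizontal axis propagates `δ 0 = 0` to the whole axis. Off the axis, a
second zero on the same vertical line would contradict Rolle. -/
theorem eventually_eq_zero_iff_snd_eq_zero {δ : Plane → ℝ} {K : ℝ}
    (hδ : ∀ᶠ x in 𝓝 (0 : Plane), DifferentiableAt ℝ δ x) (h0 : δ 0 = 0)
    (hu : ∀ᶠ x in 𝓝 (0 : Plane), |fderiv ℝ δ x (1, 0)| ≤ K * |δ x|)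
    (hv : ∀ᶠ x in 𝓝 (0 : Plane), fderiv ℝ δ x (0, 1) ≠ 0) :
    ∀ᶠ x in 𝓝 (0 : Plane), δ x = 0 ↔ x.2 = 0 := by
  obtain ⟨r, hr, hball⟩ := Metric.eventually_nhds_iff_ball.mp (hδ.and (hu.and hv))
  have hmem : ∀ x : Plane, x ∈ Metric.ball (0 : Plane) r ↔ |x.1| < r ∧ |x.2| < r := by
    intro x
    rw [mem_ball_zero_iff, Prod.norm_def, max_lt_iff, Real.norm_eq_abs, Real.norm_eq_abs]
  have habs : ∀ t ∈ Icc (0 : ℝ) 1, ∀ a : ℝ, |t * a| ≤ |a| := by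
    intro t ht a
    rw [abs_mul, abs_of_nonneg ht.1]
    exact mul_le_of_le_one_left (abs_nonneg a) ht.2
  have hzero : ∀ a : ℝ, |a| < r → δ (a, 0) = 0 := by
    intro a ha
    have hin : ∀ t ∈ Icc (0 : ℝ) 1, ((t * a, 0) : Plane) ∈ Metric.ball (0 : Plane) r := by
      intro t ht
      rw [hmem]
      exact ⟨(habs t ht a).trans_lt ha, by simpa using hr⟩
    have hd : ∀ t ∈ Icc (0 : ℝ) 1,
        HasDerivAt (fun t : ℝ => δ (t * a, 0)) (a * fderiv ℝ δ (t * a, 0) (1, 0)) t := by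
      intro t ht
      have h1 : HasDerivAt (fun t : ℝ => ((t * a, 0) : Plane)) (1 * a, 0) t :=
        ((hasDerivAt_id t).mul_const a).prodMk (hasDerivAt_const t 0)
      have h2 := (hball _ (hin t ht)).1.hasFDerivAt.comp_hasDerivAt t h1
      convert! h2 using 1
      rw [show ((1 * a, 0) : Plane) = a • (1, 0) by simp, map_smul, smul_eq_mul]
    have := eq_zero_of_abs_deriv_le_mul_abs_self_of_eq_zero_right
      (f := fun t : ℝ => δ (t * a, 0)) (f' := fun t => a * fderiv ℝ δ (t * a, 0) (1, 0))
      (K := |a| * K) (a := 0) (b := 1)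
      (fun t ht => (hd t ht).continuousAt.continuousWithinAt)
      (fun t ht => (hd t (Ico_subset_Icc_self ht)).hasDerivWithinAt)
      (by simp only [zero_mul]; exact h0)
      (fun t ht => by
        have := (hball _ (hin t (Ico_subset_Icc_self ht))).2.1
        rw [Real.norm_eq_abs, Real.norm_eq_abs, abs_mul, mul_assoc]
        exact mul_le_mul_of_nonneg_left this (abs_nonneg a)) 1 (by norm_num)
    simpa using this
  filter_upwards [Metric.ball_mem_nhds (0 : Plane) hr] with x hx
  obtain ⟨a, b⟩ := x
  obtain ⟨ha, hb⟩ := (hmem _).mp hx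
  refine ⟨fun hab => ?_, fun hab => ?_⟩
  · by_contra hb0
    have hin : ∀ t ∈ Icc (0 : ℝ) 1, ((a, t * b) : Plane) ∈ Metric.ball (0 : Plane) r := by
      intro t ht
      rw [hmem]
      exact ⟨ha, (habs t ht b).trans_lt hb⟩
    have hd : ∀ t ∈ Icc (0 : ℝ) 1,
        HasDerivAt (fun t : ℝ => δ (a, t * b)) (b * fderiv ℝ δ (a, t * b) (0, 1)) t := by
      intro t ht
      have h1 : HasDerivAt (fun t : ℝ => ((a, t * b) : Plane)) (0, 1 * b) t :=
        (hasDerivAt_const t a).prodMk ((hasDerivAt_id t).mul_const b)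
      have h2 := (hball _ (hin t ht)).1.hasFDerivAt.comp_hasDerivAt t h1
      convert! h2 using 1
      rw [show ((0, 1 * b) : Plane) = b • (0, 1) by simp, map_smul, smul_eq_mul]
    obtain ⟨t, ht, hdt⟩ := exists_hasDerivAt_eq_zero (f := fun t : ℝ => δ (a, t * b))
      (f' := fun t => b * fderiv ℝ δ (a, t * b) (0, 1)) (zero_lt_one' ℝ)
      (fun t ht => (hd t ht).continuousAt.continuousWithinAt)
      (by simp [hzero a ha, hab]) (fun t ht => hd t (Ioo_subset_Icc_self ht))
    exact mul_ne_zero hb0 (hball _ (hin t (Ioo_subset_Icc_self ht))).2.2 hdt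
  · obtain rfl : b = 0 := hab
    exact hzero a ha

theorem Configuration.IsIntegralArc.image {F G : Configuration} {Ψ : Plane → Plane} {S C : Set Plane}
    (hΨ : ∀ q ∈ S, ContDiffAt ℝ 1 Ψ q)
    (hdir : ∀ q ∈ S, ∀ w, w ≠ 0 → F.dir q w → fderiv ℝ Ψ q w ≠ 0 ∧ G.dir (Ψ q) (fderiv ℝ Ψ q w))
    (hC : F.IsIntegralArc C) (hCS : C ⊆ S) : G.IsIntegralArc (Ψ '' C) := by
  obtain ⟨a, b, γ, hab, hγ, rfl, hd⟩ := hC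
  have hS : ∀ t ∈ Ioo a b, γ t ∈ S := fun t ht => hCS (mem_image_of_mem γ ht)
  refine ⟨a, b, Ψ ∘ γ, hab, ?_, (image_comp Ψ γ _).symm, fun t ht => ?_⟩
  · intro t ht
    exact (hΨ _ (hS t ht)).comp_contDiffWithinAt t (hγ t ht)
  · have hγt : DifferentiableAt ℝ γ t :=
      ((hγ t ht).contDiffAt (isOpen_Ioo.mem_nhds ht)).differentiableAt one_ne_zero
    have : deriv (Ψ ∘ γ) t = fderiv ℝ Ψ (γ t) (deriv γ t) :=
      (((hΨ _ (hS t ht)).differentiableAt one_ne_zero).hasFDerivAt.comp_hasDerivAt t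
        hγt.hasDerivAt).deriv
    rw [this]
    exact hdir _ (hS t ht) _ (hd t ht).1 (hd t ht).2

/-- The configuration of the binary differential equation `du dv = 0`, without singularities. -/
def productConfiguration : Configuration where
  dir _ w := w.1 * w.2 = 0
  sing := ∅

/-- On `v = 0` every direction is allowed, but a tangent off both axes stays so for nearby times, by
continuity. The curve would then lie in `v = 0` and have a horizontal tangent, a contradiction. -/
theorem normalForm_isIntegralArc {C : Set Plane} (hC : normalForm.IsIntegralArc C) :
    productConfiguration.IsIntegralArc C := by
  obtain ⟨a, b, γ, hab, hγ, rfl, hd⟩ := hC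
  refine ⟨a, b, γ, hab, hγ, rfl, fun t ht => ⟨(hd t ht).1, ?_⟩⟩
  by_contra hne
  have hcont : ContinuousAt (deriv γ) t :=
    (hγ.continuousOn_deriv_of_isOpen isOpen_Ioo le_rfl).continuousAt (isOpen_Ioo.mem_nhds ht)
  have hev : ∀ᶠ x in 𝓝 t, (deriv γ x).1 * (deriv γ x).2 ≠ 0 :=
    (hcont.fst.mul hcont.snd).eventually_ne hne
  have hzero : (fun x => (γ x).2) =ᶠ[𝓝 t] fun _ => 0 := by
    filter_upwards [hev, isOpen_Ioo.mem_nhds ht] with x hx hxI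
    have := (hd x hxI).2
    simp only [normalForm, bdeConfiguration, zero_mul, zero_add, add_zero] at this
    exact (mul_eq_zero.mp this).resolve_right hx
  have hγt : HasDerivAt γ (deriv γ t) t :=
    (((hγ t ht).contDiffAt (isOpen_Ioo.mem_nhds ht)).differentiableAt one_ne_zero).hasDerivAt
  have h2 : HasDerivAt (fun x => (γ x).2) (deriv γ t).2 t := hγt.snd
  have h3 : (deriv γ t).2 = 0 := h2.unique ((hasDerivAt_const t (0 : ℝ)).congr_of_eventuallyEq hzero)
  exact hne (by change _ * _ = _; rw [h3, mul_zero])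

theorem exists_continuousLinearEquiv_of_injective {T : Plane →L[ℝ] Plane}
    (hT : ∀ w, T w = 0 → w = 0) : ∃ T' : Plane ≃L[ℝ] Plane, (T' : Plane →L[ℝ] Plane) = T := by
  have hinj : Function.Injective (T : Plane →ₗ[ℝ] Plane) :=
    (injective_iff_map_eq_zero _).mpr hT
  refine ⟨(LinearEquiv.ofInjectiveEndo _ hinj).toContinuousLinearEquiv, ?_⟩
  ext <;> rfl

theorem exists_eq_smul_add_smul {e f : Plane} (h : LinearIndependent ℝ ![e, f]) (w : Plane) :
    ∃ x y : ℝ, w = x • e + y • f := by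
  have hspan := h.span_eq_top_of_card_eq_finrank (by simp)
  have hw : w ∈ Submodule.span ℝ (range ![e, f]) := hspan ▸ Submodule.mem_top
  rw [Matrix.range_cons_cons_empty, Submodule.mem_span_pair] at hw
  obtain ⟨x, y, hxy⟩ := hw
  exact ⟨x, y, hxy.symm⟩

theorem dir_iff_mul_eq_zero {dir : Plane → Plane → Prop} {q e f : Plane}
    (h : IsTransversalPair dir q e f) {η θ : Plane →L[ℝ] ℝ} (hηe : η e = 0) (hθf : θ f = 0)
    (hηf : η f ≠ 0) (hθe : θ e ≠ 0) {w : Plane} (hw : w ≠ 0) : dir q w ↔ η w * θ w = 0 := by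
  rw [h.2 w hw]
  obtain ⟨x, y, rfl⟩ := exists_eq_smul_add_smul h.1 w
  simp only [map_add, map_smul, smul_eq_mul, hηe, hθf, mul_zero, zero_add, add_zero]
  constructor
  · rintro (⟨c, hc⟩ | ⟨c, hc⟩)
    · have := congrArg η hc
      simp only [map_add, map_smul, smul_eq_mul, hηe, mul_zero, zero_add] at this
      rw [this, zero_mul]
    · have := congrArg θ hc
      simp only [map_add, map_smul, smul_eq_mul, hθf, mul_zero, add_zero] at this
      rw [this, mul_zero]
  · intro h0
    rcases mul_eq_zero.mp h0 with h0 | h0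
    · left
      exact ⟨x, by simp [(mul_eq_zero.mp h0).resolve_right hηf]⟩
    · right
      exact ⟨y, by simp [(mul_eq_zero.mp h0).resolve_right hθe]⟩

theorem eq_zero_of_forms_eq_zero {e f : Plane} (h : LinearIndependent ℝ ![e, f])
    {η θ : Plane →L[ℝ] ℝ} (hηe : η e = 0) (hθf : θ f = 0)
    (hηf : η f ≠ 0) (hθe : θ e ≠ 0) {w : Plane} (hη : η w = 0) (hθ : θ w = 0) : w = 0 := by
  obtain ⟨x, y, rfl⟩ := exists_eq_smul_add_smul h w
  simp only [map_add, map_smul, smul_eq_mul, hηe, hθf, mul_zero, zero_add, add_zero] at hη hθ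
  simp [(mul_eq_zero.mp hη).resolve_right hηf, (mul_eq_zero.mp hθ).resolve_right hθe]

theorem form_apply_ne_zero {e f : Plane} (h : LinearIndependent ℝ ![e, f])
    {η : Plane →L[ℝ] ℝ} (hη : η ≠ 0) (hηe : η e = 0) : η f ≠ 0 := by
  intro hηf
  apply hη
  apply ContinuousLinearMap.ext
  intro w
  obtain ⟨x, y, rfl⟩ := exists_eq_smul_add_smul h w
  simp [hηe, hηf]

/-- In the coordinates `(h, g)`, with `h` constant along `e` and `g` constant along `f`, the allowed
directions become the two axes. The hypothesis `dD(f) = κ D` makes `{D = 0}` an integral curve of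
`f`, hence a level of `g`. The resulting homeomorphism is a `C¹` diffeomorphism, so it carries
regular `C¹` arcs to such arcs. -/
theorem locallyTopEquivalent_normalForm {F : Configuration} {p : Plane} {e f : Plane → Plane}
    {D κ : Plane → ℝ} (he : ContDiffAt ℝ 1 e p) (hf : ContDiffAt ℝ 1 f p)
    (hD : ContDiffAt ℝ 1 D p) (hκ : ContinuousAt κ p) (hD0 : D p = 0)
    (hDe : fderiv ℝ D p (e p) ≠ 0)
    (hDf : ∀ᶠ q in 𝓝 p, fderiv ℝ D q (f q) = κ q * D q)
    (hdir : ∀ᶠ q in 𝓝 p, IsTransversalPair F.dir q (e q) (f q))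
    (hsing : ∀ᶠ q in 𝓝 p, q ∈ F.sing ↔ D q = 0) :
    LocallyTopEquivalent F p normalForm 0 := by
  have hli := hdir.self_of_nhds.1
  obtain ⟨h, hh, hh0, hhd, hhe⟩ := exists_firstIntegral he (by simpa using hli.ne_zero 0)
  obtain ⟨g, hg, hg0, hgd, hgf⟩ := exists_firstIntegral hf (by simpa using hli.ne_zero 1)
  have hhf : fderiv ℝ h p (f p) ≠ 0 := form_apply_ne_zero hli hhd hhe.self_of_nhds
  have hge : fderiv ℝ g p (e p) ≠ 0 :=
    form_apply_ne_zero (LinearIndependent.pair_symm_iff.mp hli) hgd hgf.self_of_nhds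
  have hhc : ContinuousAt (fun q => fderiv ℝ h q (f q)) p :=
    (hh.continuousAt_fderiv one_ne_zero).clm_apply hf.continuousAt
  have hgc : ContinuousAt (fun q => fderiv ℝ g q (e q)) p :=
    (hg.continuousAt_fderiv one_ne_zero).clm_apply he.continuousAt
  have hDc : ContinuousAt (fun q => fderiv ℝ D q (e q)) p :=
    (hD.continuousAt_fderiv one_ne_zero).clm_apply he.continuousAt
  set Φ : Plane → Plane := fun q => (h q, g q) with hΦdef
  have hΦ : ContDiffAt ℝ 1 Φ p := hh.prodMk hg
  have hΦp : Φ p = 0 := by simp [hΦdef, hh0, hg0]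
  obtain ⟨T, hT⟩ : ∃ T : Plane ≃L[ℝ] Plane, (T : Plane →L[ℝ] Plane) = fderiv ℝ Φ p := by
    apply exists_continuousLinearEquiv_of_injective
    intro w hw
    rw [((hh.differentiableAt one_ne_zero).hasFDerivAt.prodMk
      (hg.differentiableAt one_ne_zero).hasFDerivAt).fderiv] at hw
    simp only [ContinuousLinearMap.prod_apply, Prod.mk_eq_zero] at hw
    exact eq_zero_of_forms_eq_zero hli hhe.self_of_nhds hgf.self_of_nhds hhf hge hw.1 hw.2
  have hΦT : HasFDerivAt Φ (T : Plane →L[ℝ] Plane) p := by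
    rw [hT]
    exact (hΦ.differentiableAt one_ne_zero).hasFDerivAt
  let E := hΦ.toOpenPartialHomeomorph Φ hΦT one_ne_zero
  have hpE : p ∈ E.source := hΦ.mem_toOpenPartialHomeomorph_source hΦT one_ne_zero
  have hE : ∀ q, E q = Φ q := fun q => rfl
  have hsymm : ContDiffAt ℝ 1 E.symm 0 := by
    have := hΦ.to_localInverse hΦT one_ne_zero
    rw [hΦp] at this
    exact this
  have hsymm0 : E.symm 0 = p := by rw [← hΦp, ← hE, E.left_inv hpE]
  have htends : Tendsto E.symm (𝓝 0) (𝓝 p) := by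
    have := hsymm.continuousAt.tendsto
    rwa [hsymm0] at this
  -- the zero set of `D` in the straightened coordinates
  have hDzero : ∀ᶠ q in 𝓝 p, D q = 0 ↔ g q = 0 := by
    set δ : Plane → ℝ := fun x => D (E.symm x) with hδdef
    have hδ1 : ContDiffAt ℝ 1 δ 0 := ContDiffAt.comp 0 (by rwa [hsymm0]) hsymm
    have hδ : ∀ᶠ x in 𝓝 (0 : Plane), DifferentiableAt ℝ δ x :=
      (hδ1.eventually (by simp)).mono fun x hx => hx.differentiableAt one_ne_zero
    have hchain : ∀ᶠ x in 𝓝 (0 : Plane), ∀ w, fderiv ℝ D (E.symm x) w =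
        fderiv ℝ δ x (fderiv ℝ h (E.symm x) w, fderiv ℝ g (E.symm x) w) := by
      have h0t : (0 : Plane) ∈ E.target := by
        rw [← hΦp, ← hE]
        exact E.map_source hpE
      filter_upwards [hδ, E.open_target.mem_nhds h0t,
        htends.eventually (hh.eventually (by simp)), htends.eventually (hg.eventually (by simp))]
        with x hx hxt hxh hxg w
      have hEx : E (E.symm x) = x := E.right_inv hxt
      have h1 : HasFDerivAt E ((fderiv ℝ h (E.symm x)).prod (fderiv ℝ g (E.symm x))) (E.symm x) :=
        (hxh.differentiableAt one_ne_zero).hasFDerivAt.prodMk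
          (hxg.differentiableAt one_ne_zero).hasFDerivAt
      have h2 : HasFDerivAt δ (fderiv ℝ δ x) (E (E.symm x)) := by rw [hEx]; exact hx.hasFDerivAt
      have h3 := h2.comp (E.symm x) h1
      have h4 : (δ ∘ E) =ᶠ[𝓝 (E.symm x)] D := by
        filter_upwards [E.open_source.mem_nhds (E.map_target hxt)] with y hy
        simp [hδdef, E.left_inv hy]
      rw [(h3.congr_of_eventuallyEq h4.symm).fderiv]
      rfl
    have hquot : ContinuousAt (fun q => κ q / fderiv ℝ h q (f q)) p := hκ.div hhc hhf
    obtain ⟨K, hK⟩ : ∃ K, ∀ᶠ q in 𝓝 p, |κ q / fderiv ℝ h q (f q)| ≤ K :=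
      ⟨|κ p / fderiv ℝ h p (f p)| + 1,
        (hquot.abs.eventually_lt_const (lt_add_one _)).mono fun q hq => hq.le⟩
    -- In these coordinates `f` is `(dh(f), 0)` and `e` is `(0, dg(e))`. Hence `δ_u = (κ / dh(f))
    -- δ`, and `δ_v ≠ 0` because `dD(e) ≠ 0`.
    have key : ∀ᶠ x in 𝓝 (0 : Plane), δ x = 0 ↔ x.2 = 0 := by
      refine eventually_eq_zero_iff_snd_eq_zero (K := K) hδ (by simp [hδdef, hsymm0, hD0]) ?_ ?_
      · filter_upwards [hchain, htends.eventually hK, htends.eventually hDf,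
          htends.eventually hgf, htends.eventually (hhc.eventually_ne hhf)] with x h1 h2 h3 h4 h5
        have h6 := h1 (f (E.symm x))
        rw [h3, h4, show ((fderiv ℝ h (E.symm x) (f (E.symm x)), (0 : ℝ)) : Plane) =
          fderiv ℝ h (E.symm x) (f (E.symm x)) • (1, 0) by simp, map_smul, smul_eq_mul] at h6
        have h7 : fderiv ℝ δ x (1, 0) =
            κ (E.symm x) / fderiv ℝ h (E.symm x) (f (E.symm x)) * δ x := by
          field_simp
          rw [mul_comm, ← h6]
        rw [h7, abs_mul]
        exact mul_le_mul_of_nonneg_right h2 (abs_nonneg _)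
      · filter_upwards [hchain, htends.eventually (hDc.eventually_ne hDe),
          htends.eventually hhe] with x h1 h2 h3 h0
        have h6 := h1 (e (E.symm x))
        rw [h3, show ((0, fderiv ℝ g (E.symm x) (e (E.symm x))) : Plane) =
          fderiv ℝ g (E.symm x) (e (E.symm x)) • (0, 1) by simp, map_smul, h0, smul_zero] at h6
        exact h2 h6
    have hΦt : Tendsto Φ (𝓝 p) (𝓝 0) := by
      have := hΦ.continuousAt.tendsto
      rwa [hΦp] at this
    filter_upwards [hΦt.eventually key, E.open_source.mem_nhds hpE] with q hq hqs
    rw [← hq, hδdef]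
    simp only [← hE, E.left_inv hqs]
  have hgood : ∀ᶠ q in 𝓝 p, (ContDiffAt ℝ 1 h q ∧ ContDiffAt ℝ 1 g q) ∧
      IsTransversalPair F.dir q (e q) (f q) ∧ (q ∈ F.sing ↔ g q = 0) ∧
      fderiv ℝ h q (e q) = 0 ∧ fderiv ℝ g q (f q) = 0 ∧
      fderiv ℝ h q (f q) ≠ 0 ∧ fderiv ℝ g q (e q) ≠ 0 := by
    filter_upwards [hh.eventually (by simp), hg.eventually (by simp), hdir, hsing, hDzero, hhe, hgf,
      hhc.eventually_ne hhf, hgc.eventually_ne hge] with q h1 h2 h3 h4 h5 h6 h7 h8 h9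
    exact ⟨⟨h1, h2⟩, h3, h4.trans h5, h6, h7, h8, h9⟩
  obtain ⟨S, hS, hSo, hpS⟩ := eventually_nhds_iff.mp hgood
  let φ := E.restrOpen S hSo
  have hφsource : φ.source = E.source ∩ S := rfl
  have hφ : ∀ q, φ q = Φ q := fun q => rfl
  have hφd : ∀ q ∈ φ.source, HasFDerivAt φ ((fderiv ℝ h q).prod (fderiv ℝ g q)) q := fun q hq =>
    ((hS q hq.2).1.1.differentiableAt one_ne_zero).hasFDerivAt.prodMk
      ((hS q hq.2).1.2.differentiableAt one_ne_zero).hasFDerivAt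
  have hφinj : ∀ q ∈ φ.source, ∀ w, fderiv ℝ φ q w = 0 → w = 0 := by
    intro q hq w hw
    obtain ⟨-, h3, -, h6, h7, h8, h9⟩ := hS q hq.2
    rw [(hφd q hq).fderiv] at hw
    simp only [ContinuousLinearMap.prod_apply, Prod.mk_eq_zero] at hw
    exact eq_zero_of_forms_eq_zero h3.1 h6 h7 h8 h9 hw.1 hw.2
  have hφdir : ∀ q ∈ φ.source, ∀ w, w ≠ 0 →
      (F.dir q w ↔ (fderiv ℝ φ q w).1 * (fderiv ℝ φ q w).2 = 0) := by
    intro q hq w hw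
    obtain ⟨-, h3, -, h6, h7, h8, h9⟩ := hS q hq.2
    rw [dir_iff_mul_eq_zero h3 h6 h7 h8 h9 hw, (hφd q hq).fderiv]
    rfl
  have hφC : ∀ q ∈ φ.source, ContDiffAt ℝ 1 φ q := fun q hq =>
    (hS q hq.2).1.1.prodMk (hS q hq.2).1.2
  refine ⟨φ, ⟨hpE, hpS⟩, hΦp, fun C hC => ⟨fun hFC => ?_, fun hGC => ?_⟩, fun q hq => ?_⟩
  · refine hFC.image hφC (fun q hq w hw hdw => ⟨fun h0 => hw (hφinj q hq w h0), ?_⟩) hC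
    have := (hφdir q hq w hw).mp hdw
    simpa [normalForm, bdeConfiguration] using Or.inr (mul_eq_zero.mp this)
  · have hequiv : ∀ q ∈ φ.source, ∃ T : Plane ≃L[ℝ] Plane,
        HasFDerivAt φ (T : Plane →L[ℝ] Plane) q := by
      intro q hq
      obtain ⟨T, hT⟩ := exists_continuousLinearEquiv_of_injective (hφinj q hq)
      exact ⟨T, by rw [hT]; exact (hφC q hq).differentiableAt one_ne_zero |>.hasFDerivAt⟩
    -- Directions cannot be pulled back pointwise from the normal form, which allows all of them on
    -- `v = 0`. The arc is first seen as an arc of `du dv = 0`.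
    have hback := (normalForm_isIntegralArc hGC).image (G := F) (Ψ := φ.symm) (S := φ.target)
      (fun x hx => by
        obtain ⟨T, hT⟩ := hequiv _ (φ.map_target hx)
        exact φ.contDiffAt_symm hx hT (hφC _ (φ.map_target hx)))
      (fun x hx w hw hdw => by
        obtain ⟨T, hT⟩ := hequiv _ (φ.map_target hx)
        have hTs := (φ.hasFDerivAt_symm hx hT).fderiv
        rw [hTs]
        have hne : T.symm w ≠ 0 := by simpa using hw
        refine ⟨hne, ?_⟩
        change F.dir _ (T.symm w)
        rw [hφdir _ (φ.map_target hx) _ hne, hT.fderiv]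
        simpa [productConfiguration] using hdw)
      (by rintro _ ⟨q, hq, rfl⟩; exact φ.map_source (hC hq))
    have hCC : φ.symm '' (φ '' C) = C := φ.toPartialEquiv.symm_image_image_of_subset_source hC
    rwa [hCC] at hback
  · rw [(hS q hq.2).2.2.1]
    -- The discriminant of `v du dv` is `v²`, so the singular set is `v² ≤ 0`.
    simp only [normalForm, bdeConfiguration, mem_ofPred_eq, mul_zero, zero_mul, sub_zero]
    rw [sq_nonpos_iff, hφ]

/-! ### Smooth eigenfields of a degenerating pencil of endomorphisms -/

/-- The oriented area `x₁ y₂ - x₂ y₁` of two vectors of the plane. -/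
def det2 (x y : Plane) : ℝ := x.1 * y.2 - x.2 * y.1

theorem linearIndependent_of_det2_ne_zero {e f : Plane} (h : det2 e f ≠ 0) :
    LinearIndependent ℝ ![e, f] := by
  rw [LinearIndependent.pair_iff]
  intro x y hxy
  have h1 : x * e.1 + y * f.1 = 0 := congrArg Prod.fst hxy
  have h2 : x * e.2 + y * f.2 = 0 := congrArg Prod.snd hxy
  constructor
  · apply (mul_eq_zero.mp (_ : x * det2 e f = 0)).resolve_right h
    unfold det2
    linear_combination f.2 * h1 - f.1 * h2
  · apply (mul_eq_zero.mp (_ : y * det2 e f = 0)).resolve_right h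
    unfold det2
    linear_combination e.1 * h2 - e.2 * h1

theorem det2_ne_zero_of_form {e f : Plane} {η : Plane →L[ℝ] ℝ} (hf0 : f ≠ 0) (hf : η f = 0)
    (he : η e ≠ 0) : det2 e f ≠ 0 := by
  intro h
  have key : ∀ w : Plane, η w = w.1 * η (1, 0) + w.2 * η (0, 1) := by
    intro w
    conv_lhs => rw [show w = w.1 • ((1, 0) : Plane) + w.2 • ((0, 1) : Plane) by ext <;> simp]
    simp only [map_add, map_smul, smul_eq_mul]
  rw [key] at hf he
  unfold det2 at h
  apply hf0
  ext
  · apply (mul_eq_zero.mp (_ : f.1 * (e.1 * η (1, 0) + e.2 * η (0, 1)) = 0)).resolve_right he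
    linear_combination e.1 * hf - η (0, 1) * h
  · apply (mul_eq_zero.mp (_ : f.2 * (e.1 * η (1, 0) + e.2 * η (0, 1)) = 0)).resolve_right he
    linear_combination e.2 * hf + η (1, 0) * h

/-- For `w = a e + b f` the determinant of `A w` and `w` is `a b (x - y)` times that of `e` and `f`.
-/
theorem det2_apply_eq_zero_iff {A : Plane →L[ℝ] Plane} {e f : Plane} {x y : ℝ} (hef : det2 e f ≠ 0)
    (he : A e = x • e) (hf : A f = y • f) (hxy : x ≠ y) (w : Plane) :
    det2 (A w) w = 0 ↔ (∃ c : ℝ, w = c • e) ∨ ∃ c : ℝ, w = c • f := by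
  constructor
  · intro h
    obtain ⟨a, b, rfl⟩ := exists_eq_smul_add_smul (linearIndependent_of_det2_ne_zero hef) w
    have h1 : a * b * ((x - y) * det2 e f) = 0 := by
      rw [← h, map_add, map_smul, map_smul, he, hf]
      simp only [det2, Prod.fst_add, Prod.snd_add, Prod.smul_fst, Prod.smul_snd, smul_eq_mul]
      ring
    rcases mul_eq_zero.mp ((mul_eq_zero.mp h1).resolve_right
      (mul_ne_zero (sub_ne_zero.mpr hxy) hef)) with h2 | h2
    · right; exact ⟨b, by simp [h2]⟩
    · left; exact ⟨a, by simp [h2]⟩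
  · rintro (⟨c, rfl⟩ | ⟨c, rfl⟩)
    · rw [map_smul, he]
      simp only [det2, Prod.smul_fst, Prod.smul_snd, smul_eq_mul]
      ring
    · rw [map_smul, hf]
      simp only [det2, Prod.smul_fst, Prod.smul_snd, smul_eq_mul]
      ring

/-- The endomorphism `w ↦ D K(w) + dD(w) Z`. -/
def pencil (D : Plane → ℝ) (K : Plane → Plane →L[ℝ] Plane) (Z : Plane → Plane) (q : Plane) :
    Plane →L[ℝ] Plane :=
  D q • K q + (fderiv ℝ D q).smulRight (Z q)

theorem pencil_apply (D : Plane → ℝ) (K : Plane → Plane →L[ℝ] Plane) (Z : Plane → Plane)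
    (q w : Plane) : pencil D K Z q w = D q • K q w + fderiv ℝ D q w • Z q := rfl

theorem contDiffAt_pencil {D : Plane → ℝ} {K : Plane → Plane →L[ℝ] Plane} {Z : Plane → Plane}
    {p : Plane} (hD : ContDiffAt ℝ ∞ D p) (hK : ContDiffAt ℝ ∞ K p) (hZ : ContDiffAt ℝ ∞ Z p) :
    ContDiffAt ℝ ∞ (pencil D K Z) p :=
  (hD.smul hK).add ((hD.fderiv_right (m := ∞) (by simp)).smulRight hZ)

/-- At `p` the pencil is `w ↦ dD(w) Z`, with eigenvalues `0` and `μ = dD(Z) ≠ 0`. They remain real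
and distinct nearby, so eigenvalues and eigenvectors can be chosen smoothly. -/
theorem exists_eigenfields_pencil {D : Plane → ℝ} {K : Plane → Plane →L[ℝ] Plane}
    {Z : Plane → Plane} {p : Plane} (hDev : ∀ᶠ q in 𝓝 p, ContDiffAt ℝ ∞ D q)
    (hKev : ∀ᶠ q in 𝓝 p, ContDiffAt ℝ ∞ K q) (hZev : ∀ᶠ q in 𝓝 p, ContDiffAt ℝ ∞ Z q) (hD0 : D p = 0) (hDZ : fderiv ℝ D p (Z p) ≠ 0) :
    ∃ (e f : Plane → Plane) (κ : Plane → ℝ),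
      (∀ᶠ q in 𝓝 p, ContDiffAt ℝ ∞ e q ∧ ContDiffAt ℝ ∞ f q) ∧
      ContinuousAt κ p ∧ fderiv ℝ D p (e p) ≠ 0 ∧
      (∀ᶠ q in 𝓝 p, fderiv ℝ D q (f q) = κ q * D q) ∧
      ∀ᶠ q in 𝓝 p, LinearIndependent ℝ ![e q, f q] ∧
        ∀ w, det2 (pencil D K Z q w) w = 0 ↔ (∃ c : ℝ, w = c • e q) ∨ ∃ c : ℝ, w = c • f q := by
  have hD := hDev.self_of_nhds
  have hK := hKev.self_of_nhds
  have hZ := hZev.self_of_nhds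
  have hAev : ∀ᶠ q in 𝓝 p, ContDiffAt ℝ ∞ (pencil D K Z) q := by
    filter_upwards [hDev, hKev, hZev] with q h1 h2 h3 using contDiffAt_pencil h1 h2 h3
  have hA := hAev.self_of_nhds
  have hdD : ContDiffAt ℝ ∞ (fderiv ℝ D) p := hD.fderiv_right (m := ∞) (by simp)
  set A := pencil D K Z with hAdef
  set a : Plane → ℝ := fun q => (A q (1, 0)).1 with ha
  set b : Plane → ℝ := fun q => (A q (0, 1)).1 with hb
  set c : Plane → ℝ := fun q => (A q (1, 0)).2 with hc
  set d : Plane → ℝ := fun q => (A q (0, 1)).2 with hd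
  have haC : ∀ q, ContDiffAt ℝ ∞ A q → ContDiffAt ℝ ∞ a q :=
    fun q hq => (hq.clm_apply contDiffAt_const).fst
  have hbC : ∀ q, ContDiffAt ℝ ∞ A q → ContDiffAt ℝ ∞ b q :=
    fun q hq => (hq.clm_apply contDiffAt_const).fst
  have hcC : ∀ q, ContDiffAt ℝ ∞ A q → ContDiffAt ℝ ∞ c q :=
    fun q hq => (hq.clm_apply contDiffAt_const).snd
  have hdC : ∀ q, ContDiffAt ℝ ∞ A q → ContDiffAt ℝ ∞ d q :=
    fun q hq => (hq.clm_apply contDiffAt_const).snd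
  have hAapp : ∀ q w, A q w = (a q * w.1 + b q * w.2, c q * w.1 + d q * w.2) := by
    intro q w
    conv_lhs => rw [show w = w.1 • ((1, 0) : Plane) + w.2 • ((0, 1) : Plane) by ext <;> simp]
    rw [map_add, map_smul, map_smul]
    ext
    · simp [ha, hb, mul_comm]
    · simp [hc, hd, mul_comm]
  set μ := fderiv ℝ D p (Z p) with hμ
  have hμ' : μ = (Z p).1 * fderiv ℝ D p (1, 0) + (Z p).2 * fderiv ℝ D p (0, 1) := by
    rw [hμ]
    conv_lhs => rw [show Z p = (Z p).1 • ((1, 0) : Plane) + (Z p).2 • ((0, 1) : Plane) by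
      ext <;> simp]
    simp only [map_add, map_smul, smul_eq_mul]
  have hAp : ∀ w, A p w = fderiv ℝ D p w • Z p := fun w => by
    rw [hAdef, pencil_apply, hD0, zero_smul, zero_add]
  have htr : a p + d p = μ := by
    simp only [ha, hd, hAp, Prod.smul_fst, Prod.smul_snd, smul_eq_mul, hμ']
    ring
  have hdet : a p * d p - b p * c p = 0 := by
    simp only [ha, hb, hc, hd, hAp, Prod.smul_fst, Prod.smul_snd, smul_eq_mul]
    ring
  set disc : Plane → ℝ := fun q => (a q + d q) ^ 2 - 4 * (a q * d q - b q * c q) with hdisc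
  have hdiscp : disc p = μ ^ 2 := by
    simp only [hdisc, hdet, htr]
    ring
  have hdiscC : ∀ q, ContDiffAt ℝ ∞ A q → ContDiffAt ℝ ∞ disc q := by
    intro q hq
    have h1 := haC q hq
    have h2 := hbC q hq
    have h3 := hcC q hq
    have h4 := hdC q hq
    fun_prop
  have hdisc_pos : 0 < disc p := by rw [hdiscp]; positivity
  -- The sign of `μ` selects the branch of the square root for which `l₁ p = μ` and `l₀ p = 0`.
  obtain ⟨σ, hσ, hσμ⟩ : ∃ σ : ℝ, σ ^ 2 = 1 ∧ σ * |μ| = μ := by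
    rcases abs_choice μ with h | h
    · exact ⟨1, by norm_num, by rw [h, one_mul]⟩
    · exact ⟨-1, by norm_num, by rw [h]; ring⟩
  set r : Plane → ℝ := fun q => σ * Real.sqrt (disc q) with hr
  have hrC : ∀ q, ContDiffAt ℝ ∞ A q → 0 < disc q → ContDiffAt ℝ ∞ r q :=
    fun q hq h0 => contDiffAt_const.mul ((hdiscC q hq).sqrt h0.ne')
  have hrp : r p = μ := by simp only [hr, hdiscp, Real.sqrt_sq_eq_abs, hσμ]
  set l₁ : Plane → ℝ := fun q => (a q + d q + r q) / 2 with hl₁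
  set l₀ : Plane → ℝ := fun q => (a q + d q - r q) / 2 with hl₀
  have hl₁C : ∀ q, ContDiffAt ℝ ∞ A q → 0 < disc q → ContDiffAt ℝ ∞ l₁ q :=
    fun q hq h0 => (((haC q hq).add (hdC q hq)).add (hrC q hq h0)).div_const 2
  have hl₀C : ∀ q, ContDiffAt ℝ ∞ A q → 0 < disc q → ContDiffAt ℝ ∞ l₀ q :=
    fun q hq h0 => (((haC q hq).add (hdC q hq)).sub (hrC q hq h0)).div_const 2
  have hl₁p : l₁ p = μ := by simp only [hl₁, htr, hrp]; ring
  have hl₀p : l₀ p = 0 := by simp only [hl₀, htr, hrp]; ring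
  -- A vector spanning the kernel of `dD` at `p`.
  set t : Plane := (-fderiv ℝ D p (0, 1), fderiv ℝ D p (1, 0)) with ht
  have hDt : fderiv ℝ D p t = 0 := by
    rw [show t = (-fderiv ℝ D p (0, 1)) • ((1, 0) : Plane) + (fderiv ℝ D p (1, 0)) • ((0, 1) : Plane)
      by ext <;> simp [ht]]
    simp only [map_add, map_smul, smul_eq_mul]
    ring
  have ht0 : t ≠ 0 := by
    intro h0
    rw [ht, Prod.mk_eq_zero, neg_eq_zero] at h0
    exact hDZ (by rw [hμ', h0.1, h0.2]; ring)
  -- By Cayley–Hamilton `(A - l₁)(A - l₀) = 0`, so `A - l₀` maps any fixed vector into the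
  -- `l₁`-eigenspace, and conversely. The seeds `Z p` and `t` give the nonzero values `μ Z(p)` and
  -- `-μ t` at `p`.
  set e : Plane → Plane := fun q => A q (Z p) - l₀ q • Z p with he
  set f : Plane → Plane := fun q => A q t - l₁ q • t with hf
  have hefC : ∀ q, ContDiffAt ℝ ∞ A q → 0 < disc q → ContDiffAt ℝ ∞ e q ∧ ContDiffAt ℝ ∞ f q :=
    fun q hq h0 =>
      ⟨(hq.clm_apply contDiffAt_const).sub ((hl₀C q hq h0).smul contDiffAt_const),
        (hq.clm_apply contDiffAt_const).sub ((hl₁C q hq h0).smul contDiffAt_const)⟩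
  obtain ⟨heC, hfC⟩ := hefC p hA hdisc_pos
  have hdisc_ev : ∀ᶠ q in 𝓝 p, 0 < disc q :=
    (hdiscC p hA).continuousAt.eventually_const_lt hdisc_pos
  have hep : e p = μ • Z p := by simp only [he, hAp, hl₀p, zero_smul, sub_zero]; rfl
  have hfp : f p = -μ • t := by simp only [hf, hAp, hDt, hl₁p, zero_smul, zero_sub, neg_smul]
  have hDe : fderiv ℝ D p (e p) ≠ 0 := by
    rw [hep, map_smul, smul_eq_mul]
    exact mul_ne_zero hDZ hDZ
  have hef : det2 (e p) (f p) ≠ 0 := by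
    refine det2_ne_zero_of_form (η := fderiv ℝ D p) ?_ ?_ hDe
    · rw [hfp]
      exact smul_ne_zero (neg_ne_zero.mpr hDZ) ht0
    · rw [hfp, map_smul, hDt, smul_zero]
  have heigen : ∀ᶠ q in 𝓝 p, l₁ q ≠ l₀ q ∧ A q (e q) = l₁ q • e q ∧ A q (f q) = l₀ q • f q := by
    filter_upwards [hdisc_ev] with q hq
    have hr2 : r q ^ 2 = disc q := by
      simp only [hr, mul_pow, hσ, one_mul, Real.sq_sqrt hq.le]
    have hsum : l₁ q + l₀ q = a q + d q := by simp only [hl₁, hl₀]; ring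
    have hprod : l₁ q * l₀ q = a q * d q - b q * c q := by
      simp only [hl₁, hl₀]
      simp only [hdisc] at hr2
      linear_combination (-1 / 4 : ℝ) * hr2
    refine ⟨fun h => ?_, ?_, ?_⟩
    · have : r q = 0 := by
        simp only [hl₁, hl₀] at h
        linarith
      rw [this] at hr2
      norm_num at hr2
      exact hq.ne hr2
    · simp only [he, hAapp]
      ext
      · simp only [Prod.fst_sub, Prod.snd_sub, Prod.smul_fst, Prod.smul_snd, smul_eq_mul]
        linear_combination (-(a q * (Z p).1 + b q * (Z p).2)) * hsum + (Z p).1 * hprod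
      · simp only [Prod.fst_sub, Prod.snd_sub, Prod.smul_fst, Prod.smul_snd, smul_eq_mul]
        linear_combination (-(c q * (Z p).1 + d q * (Z p).2)) * hsum + (Z p).2 * hprod
    · simp only [hf, hAapp]
      ext
      · simp only [Prod.fst_sub, Prod.snd_sub, Prod.smul_fst, Prod.smul_snd, smul_eq_mul]
        linear_combination (-(a q * t.1 + b q * t.2)) * hsum + t.1 * hprod
      · simp only [Prod.fst_sub, Prod.snd_sub, Prod.smul_fst, Prod.smul_snd, smul_eq_mul]
        linear_combination (-(c q * t.1 + d q * t.2)) * hsum + t.2 * hprod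
  have hdenC : ContinuousAt (fun q => fderiv ℝ D q (Z q) - l₀ q) p :=
    (hdD.clm_apply hZ).continuousAt.sub (hl₀C p hA hdisc_pos).continuousAt
  have hden : fderiv ℝ D p (Z p) - l₀ p ≠ 0 := by rw [hl₀p, sub_zero]; exact hDZ
  -- Applying `dD` to `A f = l₀ f` gives `D dD(K f) + dD(f) dD(Z) = l₀ dD(f)`. Solving for `dD(f)`
  -- produces `κ`, whose denominator is `μ` at `p`.
  refine ⟨e, f, fun q => -fderiv ℝ D q (K q (f q)) / (fderiv ℝ D q (Z q) - l₀ q), ?_, ?_,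
    hDe, ?_, ?_⟩
  · filter_upwards [hAev, hdisc_ev] with q h1 h2 using hefC q h1 h2
  · exact (hdD.clm_apply (hK.clm_apply hfC)).continuousAt.neg.div hdenC hden
  · filter_upwards [heigen, hdenC.eventually_ne hden] with q hq hne
    have h1 := congrArg (fderiv ℝ D q) hq.2.2
    rw [hAdef, pencil_apply, map_add, map_smul, map_smul, map_smul] at h1
    simp only [smul_eq_mul] at h1
    field_simp
    linear_combination h1
  · have hdetC : ContinuousAt (fun q => det2 (e q) (f q)) p := by
      have h1 := heC.continuousAt
      have h2 := hfC.continuousAt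
      unfold det2
      fun_prop
    filter_upwards [heigen, hdetC.eventually_ne hef] with q hq hne
    exact ⟨linearIndependent_of_det2_ne_zero hne,
      fun w => det2_apply_eq_zero_iff hne hq.2.1 hq.2.2 hq.1 w⟩

/-! ### Vector algebra in `ℝ³` and smoothness of the basic operations -/

theorem det3_eq (a b c : Space) : det3 a b c =
    a 0 * (b 1 * c 2 - b 2 * c 1) - a 1 * (b 0 * c 2 - b 2 * c 0) + a 2 * (b 0 * c 1 - b 1 * c 0) := by
  simp [det3, Matrix.det_fin_three]
  ring

theorem dot_eq (a b : Space) : dotProduct a b = a 0 * b 0 + a 1 * b 1 + a 2 * b 2 := by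
  simp [dotProduct, Fin.sum_univ_three]

theorem cross_zero (a b : Space) : crossProduct a b 0 = a 1 * b 2 - a 2 * b 1 := by
  simp [cross_apply]

theorem cross_one (a b : Space) : crossProduct a b 1 = a 2 * b 0 - a 0 * b 2 := by
  simp [cross_apply]

theorem cross_two (a b : Space) : crossProduct a b 2 = a 0 * b 1 - a 1 * b 0 := by
  simp [cross_apply]

/-- The product of two determinants is the determinant of the matrix of pairings. It serves to show
that `ν, ν_u, ν_v` are independent off the parabolic set. -/
theorem det3_mul_det3 (a b c x y z : Space) : det3 a b c * det3 x y z =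
    dotProduct a x * (dotProduct b y * dotProduct c z - dotProduct b z * dotProduct c y)
      - dotProduct a y * (dotProduct b x * dotProduct c z - dotProduct b z * dotProduct c x)
      + dotProduct a z * (dotProduct b x * dotProduct c y - dotProduct b y * dotProduct c x) := by
  simp only [det3_eq, dot_eq]
  ring

/-- Cramer's rule; it identifies any vector satisfying the defining pairings of the affine normal
with the cross-product formula. -/
theorem eq_inv_det3_smul_cross {a b c x : Space} (h : det3 a b c ≠ 0) (ha : dotProduct a x = 1)
    (hb : dotProduct b x = 0) (hc : dotProduct c x = 0) :
    (det3 a b c)⁻¹ • crossProduct b c = x := by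
  rw [inv_smul_eq_iff₀ h]
  rw [dot_eq] at ha hb hc
  funext i
  fin_cases i <;>
    simp only [Fin.zero_eta, Fin.mk_one, Fin.reduceFinMk, Pi.smul_apply, smul_eq_mul, det3_eq,
      cross_zero, cross_one, cross_two]
  · linear_combination (-(b 1 * c 2 - b 2 * c 1)) * ha - (c 1 * a 2 - c 2 * a 1) * hb -
      (a 1 * b 2 - a 2 * b 1) * hc
  · linear_combination (-(b 2 * c 0 - b 0 * c 2)) * ha - (c 2 * a 0 - c 0 * a 2) * hb -
      (a 2 * b 0 - a 0 * b 2) * hc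
  · linear_combination (-(b 0 * c 1 - b 1 * c 0)) * ha - (c 0 * a 1 - c 1 * a 0) * hb -
      (a 0 * b 1 - a 1 * b 0) * hc

theorem det3_smul_eq (a b c y : Space) : det3 a b c • y =
    dotProduct (crossProduct b c) y • a + dotProduct (crossProduct c a) y • b +
      dotProduct (crossProduct a b) y • c := by
  funext i
  fin_cases i <;>
    simp only [Fin.zero_eta, Fin.mk_one, Fin.reduceFinMk, Pi.smul_apply, Pi.add_apply, smul_eq_mul,
      det3_eq, dot_eq, cross_zero, cross_one, cross_two] <;> ring

theorem dot_cross_eq_det3 (a b c : Space) : dotProduct (crossProduct a b) c = det3 a b c := by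
  simp only [det3_eq, dot_eq, cross_zero, cross_one, cross_two]
  ring

theorem det3_self_cross_ne_zero {a b : Space} (h : LinearIndependent ℝ ![a, b]) :
    det3 a b (crossProduct a b) ≠ 0 := by
  rw [← dot_cross_eq_det3]
  intro h0
  rw [dotProduct_self_eq_zero] at h0
  exact crossProduct_ne_zero_iff_linearIndependent.mpr h h0

/-- The linear form `y ↦ ⟨a, y⟩`, depending linearly on `a`. -/
def dotForm (a : Space) : Space →L[ℝ] ℝ := ∑ i, a i • ContinuousLinearMap.proj i

theorem dotForm_apply (a y : Space) : dotForm a y = dotProduct a y := by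
  simp [dotForm, dotProduct]

section Smoothness

variable {n : WithTop ℕ∞} {a b c : Plane → Space} {q : Plane}

theorem contDiffAt_dot (ha : ContDiffAt ℝ n a q) (hb : ContDiffAt ℝ n b q) :
    ContDiffAt ℝ n (fun x => dotProduct (a x) (b x)) q := by
  rw [contDiffAt_pi] at ha hb
  unfold dotProduct
  exact ContDiffAt.sum fun i _ => (ha i).mul (hb i)

theorem contDiffAt_cross (ha : ContDiffAt ℝ n a q) (hb : ContDiffAt ℝ n b q) :
    ContDiffAt ℝ n (fun x => crossProduct (a x) (b x)) q := by
  rw [contDiffAt_pi] at ha hb ⊢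
  intro i
  fin_cases i <;>
    simp only [Fin.zero_eta, Fin.mk_one, Fin.reduceFinMk, cross_zero, cross_one, cross_two]
  · exact ((ha 1).mul (hb 2)).sub ((ha 2).mul (hb 1))
  · exact ((ha 2).mul (hb 0)).sub ((ha 0).mul (hb 2))
  · exact ((ha 0).mul (hb 1)).sub ((ha 1).mul (hb 0))

theorem contDiffAt_det3 (ha : ContDiffAt ℝ n a q) (hb : ContDiffAt ℝ n b q)
    (hc : ContDiffAt ℝ n c q) : ContDiffAt ℝ n (fun x => det3 (a x) (b x) (c x)) q := by
  simp only [← dot_cross_eq_det3]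
  exact contDiffAt_dot (contDiffAt_cross ha hb) hc

theorem contDiffAt_dotForm (ha : ContDiffAt ℝ n a q) : ContDiffAt ℝ n (fun x => dotForm (a x)) q := by
  rw [contDiffAt_pi] at ha
  unfold dotForm
  exact ContDiffAt.sum fun i _ => (ha i).smul contDiffAt_const

theorem fderiv_dot (ha : DifferentiableAt ℝ a q) (hb : DifferentiableAt ℝ b q) (w : Plane) :
    fderiv ℝ (fun x => dotProduct (a x) (b x)) q w =
      dotProduct (fderiv ℝ a q w) (b q) + dotProduct (a q) (fderiv ℝ b q w) := by
  have ha' := hasFDerivAt_pi'.mp ha.hasFDerivAt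
  have hb' := hasFDerivAt_pi'.mp hb.hasFDerivAt
  have := HasFDerivAt.fun_sum (u := Finset.univ) fun i _ => (ha' i).fun_mul (hb' i)
  unfold dotProduct
  rw [HasFDerivAt.fderiv this, sum_apply, ← Finset.sum_add_distrib]
  refine Finset.sum_congr rfl fun i _ => ?_
  simp
  ring

theorem contDiffAt_partialU (ha : ContDiffAt ℝ ∞ a q) : ContDiffAt ℝ ∞ (partialU a) q :=
  (ha.fderiv_right (m := ∞) (by simp)).clm_apply contDiffAt_const

theorem contDiffAt_partialV (ha : ContDiffAt ℝ ∞ a q) : ContDiffAt ℝ ∞ (partialV a) q :=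
  (ha.fderiv_right (m := ∞) (by simp)).clm_apply contDiffAt_const

theorem fderiv_fderiv_apply (ha : ContDiffAt ℝ ∞ a q) (v w : Plane) :
    fderiv ℝ (fun x => fderiv ℝ a x v) q w = fderiv ℝ (fderiv ℝ a) q w v := by
  have h : DifferentiableAt ℝ (fderiv ℝ a) q :=
    (ha.fderiv_right (m := ∞) (by simp)).differentiableAt (by simp)
  rw [(h.hasFDerivAt.clm_apply (hasFDerivAt_const v q)).fderiv]
  simp

theorem partialU_partialV (ha : ContDiffAt ℝ ∞ a q) :
    partialU (partialV a) q = partialV (partialU a) q := by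
  have hs := ha.isSymmSndFDerivAt
    (by rw [minSmoothness_of_isRCLikeNormedField]; exact WithTop.coe_le_coe.mpr (le_top : (2 : ℕ∞) ≤ ⊤))
  change fderiv ℝ (fun x => fderiv ℝ a x (0, 1)) q (1, 0) =
    fderiv ℝ (fun x => fderiv ℝ a x (1, 0)) q (0, 1)
  rw [fderiv_fderiv_apply ha, fderiv_fderiv_apply ha]
  exact hs _ _

end Smoothness

theorem clm_apply_eq {E : Type*} [NormedAddCommGroup E] [NormedSpace ℝ E] (T : Plane →L[ℝ] E)
    (w : Plane) : T w = w.1 • T (1, 0) + w.2 • T (0, 1) := by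
  conv_lhs => rw [show w = w.1 • ((1, 0) : Plane) + w.2 • ((0, 1) : Plane) by ext <;> simp]
  rw [map_add, map_smul, map_smul]

theorem fderiv_eq_partials (f : Plane → Space) (q w : Plane) :
    fderiv ℝ f q w = w.1 • partialU f q + w.2 • partialV f q :=
  clm_apply_eq _ w

/-! ### The affine normal in a frame `X_u, X_v, k` with `k` constant -/

/-- The determinant `|X_u, X_v, k|` for a constant vector `k`. -/
def rho (X : Plane → Space) (k : Space) (q : Plane) : ℝ := det3 (partialU X q) (partialV X q) k

/-- The coordinates along `X_u`, `X_v` of a vector of `ℝ³` in the frame `X_u, X_v, k`. -/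
def tangentCoords (X : Plane → Space) (k : Space) (q : Plane) : Space →L[ℝ] Plane :=
  (rho X k q)⁻¹ •
    ((ContinuousLinearMap.inl ℝ ℝ ℝ).comp (dotForm (crossProduct (partialV X q) k)) +
      (ContinuousLinearMap.inr ℝ ℝ ℝ).comp (dotForm (crossProduct k (partialU X q))))

/-- The linear form `dD / 4 - D dρ / ρ`. -/
def tauForm (X : Plane → Space) (k : Space) (q : Plane) : Plane →L[ℝ] ℝ :=
  (1 / 4 : ℝ) • fderiv ℝ (hessDet X) q - (hessDet X q / rho X k q) • fderiv ℝ (rho X k) q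

/-- The `X_u`, `X_v` coordinates of the affine normal, divided by `|D|^(1/4) D⁻²`. -/
def normalField (X : Plane → Space) (k : Space) (q : Plane) : Plane :=
  (-(coeffN X q * tauForm X k q (1, 0) - coeffM X q * tauForm X k q (0, 1)),
    -(coeffL X q * tauForm X k q (0, 1) - coeffM X q * tauForm X k q (1, 0)))

/-- The covariant derivative of `normalField`. -/
def covariantDeriv (X : Plane → Space) (k : Space) (q : Plane) : Plane →L[ℝ] Plane :=
  fderiv ℝ (normalField X k) q +
    ((normalField X k q).1 • (tangentCoords X k q).comp (fderiv ℝ (partialU X) q) +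
      (normalField X k q).2 • (tangentCoords X k q).comp (fderiv ℝ (partialV X) q))

/-- The affine shape operator times `-|D|^(-1/4) D³`. -/
def shapePencil (X : Plane → Space) (k : Space) : Plane → Plane →L[ℝ] Plane :=
  pencil (hessDet X) (covariantDeriv X k) (fun q => (-7 / 4 : ℝ) • normalField X k q)

/-- The affine normal, expressed in the frame `X_u, X_v, k`. -/
def frameNormal (X : Plane → Space) (k : Space) (q : Plane) : Space :=
  (|hessDet X q| ^ (1 / 4 : ℝ) / hessDet X q ^ 2 * (normalField X k q).1) • partialU X q +
    (|hessDet X q| ^ (1 / 4 : ℝ) / hessDet X q ^ 2 * (normalField X k q).2) • partialV X q +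
    (|hessDet X q| ^ (1 / 4 : ℝ) / rho X k q) • k

section Smoothness

variable {X : Plane → Space} {k : Space} {q : Plane}

theorem contDiffAt_rho (hX : ContDiffAt ℝ ∞ X q) : ContDiffAt ℝ ∞ (rho X k) q :=
  contDiffAt_det3 (contDiffAt_partialU hX) (contDiffAt_partialV hX) contDiffAt_const

theorem contDiffAt_coeffL (hX : ContDiffAt ℝ ∞ X q) : ContDiffAt ℝ ∞ (coeffL X) q :=
  contDiffAt_det3 (contDiffAt_partialU hX) (contDiffAt_partialV hX)
    (contDiffAt_partialU (contDiffAt_partialU hX))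

theorem contDiffAt_coeffM (hX : ContDiffAt ℝ ∞ X q) : ContDiffAt ℝ ∞ (coeffM X) q :=
  contDiffAt_det3 (contDiffAt_partialU hX) (contDiffAt_partialV hX)
    (contDiffAt_partialV (contDiffAt_partialU hX))

theorem contDiffAt_coeffN (hX : ContDiffAt ℝ ∞ X q) : ContDiffAt ℝ ∞ (coeffN X) q :=
  contDiffAt_det3 (contDiffAt_partialU hX) (contDiffAt_partialV hX)
    (contDiffAt_partialV (contDiffAt_partialV hX))

theorem contDiffAt_hessDet (hX : ContDiffAt ℝ ∞ X q) : ContDiffAt ℝ ∞ (hessDet X) q :=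
  ((contDiffAt_coeffL hX).mul (contDiffAt_coeffN hX)).sub ((contDiffAt_coeffM hX).pow 2)

theorem contDiffAt_tangentCoords (hX : ContDiffAt ℝ ∞ X q) (hρ : rho X k q ≠ 0) :
    ContDiffAt ℝ ∞ (tangentCoords X k) q := by
  refine ((contDiffAt_rho hX).inv hρ).smul ?_
  exact (contDiffAt_const.clm_comp
      (contDiffAt_dotForm (contDiffAt_cross (contDiffAt_partialV hX) contDiffAt_const))).add
    (contDiffAt_const.clm_comp
      (contDiffAt_dotForm (contDiffAt_cross contDiffAt_const (contDiffAt_partialU hX))))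

theorem contDiffAt_tauForm (hX : ContDiffAt ℝ ∞ X q) (hρ : rho X k q ≠ 0) :
    ContDiffAt ℝ ∞ (tauForm X k) q := by
  have hD := contDiffAt_hessDet hX
  have hr := contDiffAt_rho (k := k) hX
  exact ((hD.fderiv_right (m := ∞) (by simp)).const_smul (1 / 4 : ℝ)).sub
    ((hD.div hr hρ).smul (hr.fderiv_right (m := ∞) (by simp)))

theorem contDiffAt_normalField (hX : ContDiffAt ℝ ∞ X q) (hρ : rho X k q ≠ 0) :
    ContDiffAt ℝ ∞ (normalField X k) q := by
  have hτ := contDiffAt_tauForm hX hρ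
  have hu := hτ.clm_apply (contDiffAt_const (c := ((1, 0) : Plane)))
  have hv := hτ.clm_apply (contDiffAt_const (c := ((0, 1) : Plane)))
  exact (((contDiffAt_coeffN hX).mul hu).sub ((contDiffAt_coeffM hX).mul hv)).neg.prodMk
    (((contDiffAt_coeffL hX).mul hv).sub ((contDiffAt_coeffM hX).mul hu)).neg

theorem contDiffAt_covariantDeriv (hX : ContDiffAt ℝ ∞ X q) (hρ : rho X k q ≠ 0) :
    ContDiffAt ℝ ∞ (covariantDeriv X k) q := by
  have hZ := contDiffAt_normalField hX hρ
  have hT := contDiffAt_tangentCoords hX hρ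
  exact (hZ.fderiv_right (m := ∞) (by simp)).add
    ((hZ.fst.smul (hT.clm_comp ((contDiffAt_partialU hX).fderiv_right (m := ∞) (by simp)))).add
      (hZ.snd.smul (hT.clm_comp ((contDiffAt_partialV hX).fderiv_right (m := ∞) (by simp)))))

theorem contDiffAt_shapePencil (hX : ContDiffAt ℝ ∞ X q) (hρ : rho X k q ≠ 0) :
    ContDiffAt ℝ ∞ (shapePencil X k) q :=
  contDiffAt_pencil (contDiffAt_hessDet hX) (contDiffAt_covariantDeriv hX hρ)
    ((contDiffAt_normalField hX hρ).const_smul (-7 / 4 : ℝ))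

end Smoothness

section Pointwise

variable {X : Plane → Space} {k : Space} {q : Plane}

theorem decompose_frame (hρ : rho X k q ≠ 0) (y : Space) :
    y = (tangentCoords X k q y).1 • partialU X q + (tangentCoords X k q y).2 • partialV X q +
      (det3 (partialU X q) (partialV X q) y / rho X k q) • k := by
  have h := det3_smul_eq (partialU X q) (partialV X q) k y
  rw [dot_cross_eq_det3 (partialU X q)] at h
  have hcoords : tangentCoords X k q y =
      (rho X k q)⁻¹ • (dotProduct (crossProduct (partialV X q) k) y,
        dotProduct (crossProduct k (partialU X q)) y) := by
    rw [← dotForm_apply, ← dotForm_apply]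
    ext <;> simp [tangentCoords]
  rw [hcoords, div_eq_inv_mul]
  simp only [Prod.smul_fst, Prod.smul_snd, smul_eq_mul]
  rw [mul_smul, mul_smul, mul_smul, ← smul_add, ← smul_add, ← h]
  exact (inv_smul_smul₀ hρ y).symm

theorem det3_fderiv_partialU (w : Plane) :
    det3 (partialU X q) (partialV X q) (fderiv ℝ (partialU X) q w) =
      w.1 * coeffL X q + w.2 * coeffM X q := by
  rw [fderiv_eq_partials]
  simp only [coeffL, coeffM, det3_eq, Pi.add_apply, Pi.smul_apply, smul_eq_mul]
  ring

theorem det3_fderiv_partialV (hX : ContDiffAt ℝ ∞ X q) (w : Plane) :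
    det3 (partialU X q) (partialV X q) (fderiv ℝ (partialV X) q w) =
      w.1 * coeffM X q + w.2 * coeffN X q := by
  rw [fderiv_eq_partials, partialU_partialV hX]
  simp only [coeffM, coeffN, det3_eq, Pi.add_apply, Pi.smul_apply, smul_eq_mul]
  ring

/-- `normalField` is minus the adjugate of the second form applied to `tauForm`, and the adjugate
times the form is `D`. This is the identity that cancels the `k`-component of `dξ`. -/
theorem normalField_hess (X : Plane → Space) (k : Space) (q w : Plane) :
    (normalField X k q).1 * (w.1 * coeffL X q + w.2 * coeffM X q) +
      (normalField X k q).2 * (w.1 * coeffM X q + w.2 * coeffN X q) =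
      -(hessDet X q * tauForm X k q w) := by
  rw [clm_apply_eq (tauForm X k q) w]
  simp only [normalField, hessDet, smul_eq_mul]
  ring

theorem hasDerivAt_abs_rpow_quarter {x : ℝ} (hx : x ≠ 0) :
    HasDerivAt (fun y : ℝ => |y| ^ (1 / 4 : ℝ)) (|x| ^ (1 / 4 : ℝ) / (4 * x)) x := by
  have h := (hasDerivAt_abs hx).rpow_const (p := (1 / 4 : ℝ)) (Or.inl (abs_ne_zero.mpr hx))
  convert! h using 1
  rw [Real.rpow_sub_one (abs_ne_zero.mpr hx)]
  rcases hx.lt_or_gt with h | h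
  · rw [abs_of_neg h, sign_neg h]
    simp
    field_simp
  · rw [abs_of_pos h, sign_pos h]
    simp
    field_simp

/-- The factor `-7/4` is the exponent `1/4 - 2` of the coefficient `|D|^(1/4) D⁻²`. -/
theorem fderiv_normalCoeff {D z : Plane → ℝ} (hD : DifferentiableAt ℝ D q)
    (hz : DifferentiableAt ℝ z q) (h0 : D q ≠ 0) :
    DifferentiableAt ℝ (fun x => |D x| ^ (1 / 4 : ℝ) / D x ^ 2 * z x) q ∧ ∀ w,
      fderiv ℝ (fun x => |D x| ^ (1 / 4 : ℝ) / D x ^ 2 * z x) q w =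
        |D q| ^ (1 / 4 : ℝ) / D q ^ 3 *
          (D q * fderiv ℝ z q w - 7 / 4 * fderiv ℝ D q w * z q) := by
  have h1 := (hasDerivAt_abs_rpow_quarter h0).fun_div (hasDerivAt_pow 2 (D q)) (pow_ne_zero 2 h0)
  have h2 := (h1.comp_hasFDerivAt q hD.hasFDerivAt).fun_mul hz.hasFDerivAt
  refine ⟨h2.differentiableAt, fun w => ?_⟩
  have h3 := DFunLike.congr_fun h2.fderiv w
  simp only [Function.comp_apply] at h3
  rw [h3]
  simp only [add_apply, smul_apply, smul_eq_mul]
  field_simp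
  ring

theorem fderiv_transversalCoeff {D r : Plane → ℝ} (hD : DifferentiableAt ℝ D q)
    (hr : DifferentiableAt ℝ r q) (h0 : D q ≠ 0) (hr0 : r q ≠ 0) :
    DifferentiableAt ℝ (fun x => |D x| ^ (1 / 4 : ℝ) / r x) q ∧ ∀ w,
      fderiv ℝ (fun x => |D x| ^ (1 / 4 : ℝ) / r x) q w =
        |D q| ^ (1 / 4 : ℝ) / (r q * D q) *
          (1 / 4 * fderiv ℝ D q w - D q / r q * fderiv ℝ r q w) := by
  have h2 := ((hasDerivAt_abs_rpow_quarter h0).comp_hasFDerivAt q hD.hasFDerivAt).fun_mul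
    ((hasDerivAt_inv hr0).comp_hasFDerivAt q hr.hasFDerivAt)
  simp only [Function.comp_apply, ← div_eq_mul_inv] at h2
  refine ⟨h2.differentiableAt, fun w => ?_⟩
  rw [h2.fderiv]
  simp only [add_apply, smul_apply, smul_eq_mul]
  field_simp
  ring

/-- The derivatives of `X_u` and `X_v` contribute to the `k`-direction through the second form, and
the `k`-coefficient contributes `tauForm`. By `normalField_hess` these cancel, so `dξ` is tangent.
All negative powers of `D` gather in one scalar, leaving an endomorphism that is smooth across `D =
0`. -/
theorem differentiableAt_frameNormal (hX : ContDiffAt ℝ ∞ X q) (hρ : rho X k q ≠ 0)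
    (hD : hessDet X q ≠ 0) (w : Plane) : DifferentiableAt ℝ (frameNormal X k) q ∧
    fderiv ℝ (frameNormal X k) q w =
      (|hessDet X q| ^ (1 / 4 : ℝ) / hessDet X q ^ 3) • fderiv ℝ X q (shapePencil X k q w) := by
  have hDd := (contDiffAt_hessDet hX).differentiableAt (by simp)
  have hrd := (contDiffAt_rho (k := k) hX).differentiableAt (by simp)
  have hZ := (contDiffAt_normalField hX hρ).differentiableAt (by simp)
  have hUd := (contDiffAt_partialU hX).differentiableAt (by simp)
  have hVd := (contDiffAt_partialV hX).differentiableAt (by simp)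
  obtain ⟨ha, ha'⟩ := fderiv_normalCoeff hDd hZ.fst hD
  obtain ⟨hb, hb'⟩ := fderiv_normalCoeff hDd hZ.snd hD
  obtain ⟨hc, hc'⟩ := fderiv_transversalCoeff hDd hrd hD hρ
  have hall := ((ha.hasFDerivAt.fun_smul hUd.hasFDerivAt).fun_add
    (hb.hasFDerivAt.fun_smul hVd.hasFDerivAt)).fun_add
    (hc.hasFDerivAt.fun_smul (hasFDerivAt_const k q))
  have hall' : HasFDerivAt (frameNormal X k) _ q := hall
  refine ⟨hall'.differentiableAt, ?_⟩
  rw [hall'.fderiv]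
  simp only [add_apply, smul_apply,
    ContinuousLinearMap.smulRight_apply, ha', hb', hc', smul_zero,
    zero_add]
  have hz1 : fderiv ℝ (fun x => (normalField X k x).1) q w = (fderiv ℝ (normalField X k) q w).1 := by
    rw [hZ.hasFDerivAt.fst.fderiv]; rfl
  have hz2 : fderiv ℝ (fun x => (normalField X k x).2) q w = (fderiv ℝ (normalField X k) q w).2 := by
    rw [hZ.hasFDerivAt.snd.fderiv]; rfl
  rw [hz1, hz2]
  have hU := decompose_frame hρ (fderiv ℝ (partialU X) q w)
  have hV := decompose_frame hρ (fderiv ℝ (partialV X) q w)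
  rw [det3_fderiv_partialU] at hU
  rw [det3_fderiv_partialV hX] at hV
  have hn := normalField_hess X k q w
  have hτ : tauForm X k q w = 1 / 4 * fderiv ℝ (hessDet X) q w -
    hessDet X q / rho X k q * fderiv ℝ (rho X k) q w := rfl
  rw [← hτ]
  have hA : shapePencil X k q w = hessDet X q • (fderiv ℝ (normalField X k) q w +
      ((normalField X k q).1 • tangentCoords X k q (fderiv ℝ (partialU X) q w) +
      (normalField X k q).2 • tangentCoords X k q (fderiv ℝ (partialV X) q w))) +
      fderiv ℝ (hessDet X) q w • ((-7 / 4 : ℝ) • normalField X k q) := rfl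
  rw [fderiv_eq_partials X q, hA]
  funext i
  have hUi := congrFun hU i
  have hVi := congrFun hV i
  simp only [Pi.add_apply, Pi.smul_apply, smul_eq_mul, Prod.fst_add, Prod.snd_add, Prod.smul_fst,
    Prod.smul_snd] at hUi hVi ⊢
  rw [hUi, hVi]
  -- Rewriting `tauForm` through the second form turns the cancellation of the `k`-components into a
  -- field identity.
  have ht : tauForm X k q w = -((normalField X k q).1 * (w.1 * coeffL X q + w.2 * coeffM X q) +
      (normalField X k q).2 * (w.1 * coeffM X q + w.2 * coeffN X q)) / hessDet X q := by
    rw [hn]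
    field_simp
  rw [ht]
  field_simp
  ring

end Pointwise

/-! ### Conormal pairings and the equation of affine curvature lines -/

section Conormal

variable {X : Plane → Space} {k : Space} {q : Plane}

theorem contDiffAt_abs_rpow {D : Plane → ℝ} (hD : ContDiffAt ℝ ∞ D q) (h0 : D q ≠ 0) (r : ℝ) :
    ContDiffAt ℝ ∞ (fun x => |D x| ^ r) q := by
  have h := ((contDiffAt_abs h0).comp q hD).rpow_const_of_ne (p := r) (abs_ne_zero.mpr h0)
  exact h

theorem contDiffAt_conormal (hX : ContDiffAt ℝ ∞ X q) (hD : hessDet X q ≠ 0) :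
    ContDiffAt ℝ ∞ (conormal X) q :=
  (contDiffAt_abs_rpow (contDiffAt_hessDet hX) hD _).smul
    (contDiffAt_cross (contDiffAt_partialU hX) (contDiffAt_partialV hX))

theorem conormal_dot (X : Plane → Space) (q : Plane) (y : Space) :
    dotProduct (conormal X q) y =
      |hessDet X q| ^ (-(1 / 4) : ℝ) * det3 (partialU X q) (partialV X q) y := by
  rw [conormal, smul_dotProduct, dot_cross_eq_det3, smul_eq_mul]

theorem abs_rpow_neg_mul {x : ℝ} (hx : x ≠ 0) :
    |x| ^ (-(1 / 4) : ℝ) * |x| ^ (1 / 4 : ℝ) = 1 := by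
  rw [← Real.rpow_add (abs_pos.mpr hx)]
  simp

theorem conormal_dot_tangent (X : Plane → Space) (q w : Plane) :
    dotProduct (conormal X q) (fderiv ℝ X q w) = 0 := by
  rw [conormal_dot, fderiv_eq_partials]
  apply mul_eq_zero_of_right
  simp only [det3_eq, Pi.add_apply, Pi.smul_apply, smul_eq_mul]
  ring

theorem conormal_dot_frameNormal (hρ : rho X k q ≠ 0) (hD : hessDet X q ≠ 0) :
    dotProduct (conormal X q) (frameNormal X k q) = 1 := by
  rw [← abs_rpow_neg_mul hD, conormal_dot]
  congr 1
  have h : |hessDet X q| ^ (1 / 4 : ℝ) =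
      |hessDet X q| ^ (1 / 4 : ℝ) / rho X k q * rho X k q := by field_simp
  conv_rhs => rw [h]
  simp only [frameNormal, rho, det3_eq, Pi.add_apply, Pi.smul_apply, smul_eq_mul]
  ring

/-- Differentiate `⟨ν, X_u⟩ = 0`. -/
theorem fderiv_conormal_dot_partialU (hX : ContDiffAt ℝ ∞ X q) (hD : hessDet X q ≠ 0) (w : Plane) :
    dotProduct (fderiv ℝ (conormal X) q w) (partialU X q) =
      -(|hessDet X q| ^ (-(1 / 4) : ℝ) * (w.1 * coeffL X q + w.2 * coeffM X q)) := by
  have h := fderiv_dot ((contDiffAt_conormal hX hD).differentiableAt (by simp))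
    ((contDiffAt_partialU hX).differentiableAt (by simp)) w
  have h0 : (fun x => dotProduct (conormal X x) (partialU X x)) = fun _ => 0 :=
    funext fun x => conormal_dot_tangent X x (1, 0)
  rw [h0, conormal_dot, det3_fderiv_partialU] at h
  simp only [fderiv_fun_const, Pi.zero_apply, zero_apply] at h
  linarith

theorem fderiv_conormal_dot_partialV (hX : ContDiffAt ℝ ∞ X q) (hD : hessDet X q ≠ 0) (w : Plane) :
    dotProduct (fderiv ℝ (conormal X) q w) (partialV X q) =
      -(|hessDet X q| ^ (-(1 / 4) : ℝ) * (w.1 * coeffM X q + w.2 * coeffN X q)) := by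
  have h := fderiv_dot ((contDiffAt_conormal hX hD).differentiableAt (by simp))
    ((contDiffAt_partialV hX).differentiableAt (by simp)) w
  have h0 : (fun x => dotProduct (conormal X x) (partialV X x)) = fun _ => 0 :=
    funext fun x => conormal_dot_tangent X x (0, 1)
  rw [h0, conormal_dot, det3_fderiv_partialV hX] at h
  simp only [fderiv_fun_const, Pi.zero_apply, zero_apply] at h
  linarith

theorem fderiv_conormal_dot_tangent (hX : ContDiffAt ℝ ∞ X q) (hD : hessDet X q ≠ 0)
    (w w' : Plane) :
    dotProduct (fderiv ℝ (conormal X) q w) (fderiv ℝ X q w') =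
      -(|hessDet X q| ^ (-(1 / 4) : ℝ) * (w'.1 * (w.1 * coeffL X q + w.2 * coeffM X q) +
        w'.2 * (w.1 * coeffM X q + w.2 * coeffN X q))) := by
  rw [fderiv_eq_partials X, dotProduct_add, dotProduct_smul, dotProduct_smul,
    fderiv_conormal_dot_partialU hX hD, fderiv_conormal_dot_partialV hX hD]
  simp only [smul_eq_mul]
  ring

end Conormal

section Normal

variable {X : Plane → Space} {k : Space} {O : Set Plane} {q : Plane}

theorem isOpen_nonparabolic (hO : IsOpen O) (hX : ∀ q ∈ O, ContDiffAt ℝ ∞ X q) :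
    IsOpen {q | q ∈ O ∧ hessDet X q ≠ 0} := by
  rw [isOpen_iff_mem_nhds]
  rintro q ⟨hq, hD⟩
  exact Filter.Eventually.and (hO.mem_nhds hq) ((contDiffAt_hessDet (hX q hq)).continuousAt.eventually_ne hD)

/-- Differentiate `⟨ν, ξ⟩ = 1`: the term `⟨ν, dξ⟩` vanishes because `dξ` is tangent to the surface.
-/
theorem fderiv_conormal_dot_frameNormal (hO : IsOpen O) (hX : ∀ q ∈ O, ContDiffAt ℝ ∞ X q)
    (hρ : ∀ q ∈ O, rho X k q ≠ 0) (hq : q ∈ O) (hD : hessDet X q ≠ 0) (w : Plane) :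
    dotProduct (fderiv ℝ (conormal X) q w) (frameNormal X k q) = 0 := by
  obtain ⟨hd, hdw⟩ := differentiableAt_frameNormal (hX q hq) (hρ q hq) hD w
  have h := fderiv_dot ((contDiffAt_conormal (hX q hq) hD).differentiableAt (by simp)) hd w
  have h1 : (fun x => dotProduct (conormal X x) (frameNormal X k x)) =ᶠ[𝓝 q] fun _ => 1 := by
    filter_upwards [(isOpen_nonparabolic hO hX).mem_nhds ⟨hq, hD⟩] with x hx
    exact conormal_dot_frameNormal (hρ x hx.1) hx.2
  rw [h1.fderiv_eq, hdw, dotProduct_smul, conormal_dot_tangent] at h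
  simpa using h.symm

theorem affineNormal_eq_frameNormal (hO : IsOpen O) (hX : ∀ q ∈ O, ContDiffAt ℝ ∞ X q)
    (hρ : ∀ q ∈ O, rho X k q ≠ 0) (hq : q ∈ O) (hD : hessDet X q ≠ 0) :
    affineNormal X q = frameNormal X k q := by
  have hu := fderiv_conormal_dot_frameNormal hO hX hρ hq hD (1, 0)
  have hv := fderiv_conormal_dot_frameNormal hO hX hρ hq hD (0, 1)
  have h1 := conormal_dot_frameNormal (hρ q hq) hD
  refine eq_inv_det3_smul_cross ?_ h1 hu hv
  have hφ : |hessDet X q| ^ (-(1 / 4) : ℝ) ≠ 0 := (Real.rpow_pos_of_pos (abs_pos.mpr hD) _).ne'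
  -- The pairing matrix of `(ν, ν_u, ν_v)` with `(ξ, X_u, X_v)` is block diagonal, with determinant
  -- `(|D|^(-1/4))² D ≠ 0`.
  have h := det3_mul_det3 (conormal X q) (fderiv ℝ (conormal X) q (1, 0))
    (fderiv ℝ (conormal X) q (0, 1)) (frameNormal X k q) (partialU X q) (partialV X q)
  rw [h1, hu, hv, fderiv_conormal_dot_partialU (hX q hq) hD,
    fderiv_conormal_dot_partialV (hX q hq) hD, fderiv_conormal_dot_partialU (hX q hq) hD,
    fderiv_conormal_dot_partialV (hX q hq) hD] at h
  intro h0
  change det3 (conormal X q) (fderiv ℝ (conormal X) q (1, 0))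
    (fderiv ℝ (conormal X) q (0, 1)) = 0 at h0
  rw [h0] at h
  have h2 : (|hessDet X q| ^ (-(1 / 4) : ℝ)) ^ 2 * hessDet X q = 0 := by
    simp only [hessDet] at h ⊢
    linear_combination -h
  exact mul_ne_zero (pow_ne_zero 2 hφ) hD h2

theorem affineNormal_eventuallyEq (hO : IsOpen O) (hX : ∀ q ∈ O, ContDiffAt ℝ ∞ X q)
    (hρ : ∀ q ∈ O, rho X k q ≠ 0) (hq : q ∈ O) (hD : hessDet X q ≠ 0) :
    affineNormal X =ᶠ[𝓝 q] frameNormal X k := by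
  filter_upwards [(isOpen_nonparabolic hO hX).mem_nhds ⟨hq, hD⟩] with x hx
  exact affineNormal_eq_frameNormal hO hX hρ hx.1 hx.2

theorem fderiv_affineNormal (hO : IsOpen O) (hX : ∀ q ∈ O, ContDiffAt ℝ ∞ X q)
    (hρ : ∀ q ∈ O, rho X k q ≠ 0) (hq : q ∈ O) (hD : hessDet X q ≠ 0) (w : Plane) :
    fderiv ℝ (affineNormal X) q w =
      (|hessDet X q| ^ (1 / 4 : ℝ) / hessDet X q ^ 3) • fderiv ℝ X q (shapePencil X k q w) := by
  rw [(affineNormal_eventuallyEq hO hX hρ hq hD).fderiv_eq]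
  exact (differentiableAt_frameNormal (hX q hq) (hρ q hq) hD w).2

theorem thirdForm_eq (hO : IsOpen O) (hX : ∀ q ∈ O, ContDiffAt ℝ ∞ X q)
    (hρ : ∀ q ∈ O, rho X k q ≠ 0) (hq : q ∈ O) (hD : hessDet X q ≠ 0) (w w' : Plane) :
    dotProduct (fderiv ℝ (conormal X) q w) (fderiv ℝ (affineNormal X) q w') =
      -(((shapePencil X k q w').1 * (w.1 * coeffL X q + w.2 * coeffM X q) +
        (shapePencil X k q w').2 * (w.1 * coeffM X q + w.2 * coeffN X q)) / hessDet X q ^ 3) := by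
  rw [fderiv_affineNormal hO hX hρ hq hD, dotProduct_smul,
    fderiv_conormal_dot_tangent (hX q hq) hD, smul_eq_mul]
  have h := abs_rpow_neg_mul hD
  linear_combination (-((shapePencil X k q w').1 * (w.1 * coeffL X q + w.2 * coeffM X q) +
    (shapePencil X k q w').2 * (w.1 * coeffM X q + w.2 * coeffN X q)) / hessDet X q ^ 3) * h

/-- Differentiate `⟨ν_u, ξ⟩ = 0` in `v` and `⟨ν_v, ξ⟩ = 0` in `u`, then use `ν_uv = ν_vu`. This
supplies a second expression for `m`, needed to invert the second form in the curvature equation. -/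
theorem thirdForm_symm (hO : IsOpen O) (hX : ∀ q ∈ O, ContDiffAt ℝ ∞ X q)
    (hρ : ∀ q ∈ O, rho X k q ≠ 0) (hq : q ∈ O) (hD : hessDet X q ≠ 0) :
    dotProduct (partialU (conormal X) q) (partialV (affineNormal X) q) =
      dotProduct (partialV (conormal X) q) (partialU (affineNormal X) q) := by
  have hν := contDiffAt_conormal (hX q hq) hD
  have hξ := (differentiableAt_frameNormal (hX q hq) (hρ q hq) hD 0).1
  have heq := affineNormal_eventuallyEq hO hX hρ hq hD
  have hξ' : DifferentiableAt ℝ (affineNormal X) q := hξ.congr_of_eventuallyEq heq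
  have hzero : ∀ w, (fun x => dotProduct (fderiv ℝ (conormal X) x w) (affineNormal X x))
      =ᶠ[𝓝 q] fun _ => 0 := by
    intro w
    filter_upwards [(isOpen_nonparabolic hO hX).mem_nhds ⟨hq, hD⟩] with x hx
    rw [affineNormal_eq_frameNormal hO hX hρ hx.1 hx.2]
    exact fderiv_conormal_dot_frameNormal hO hX hρ hx.1 hx.2 w
  have h1 := fderiv_dot ((contDiffAt_partialU hν).differentiableAt (by simp)) hξ' (0, 1)
  have h2 := fderiv_dot ((contDiffAt_partialV hν).differentiableAt (by simp)) hξ' (1, 0)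
  have e1 : fderiv ℝ (fun x => dotProduct (partialU (conormal X) x) (affineNormal X x)) q (0, 1) = 0 := by
    
    exact (DFunLike.congr_fun (hzero (1, 0)).fderiv_eq (0, 1)).trans (by simp)
  have e2 : fderiv ℝ (fun x => dotProduct (partialV (conormal X) x) (affineNormal X x)) q (1, 0) = 0 := by
    
    exact (DFunLike.congr_fun (hzero (0, 1)).fderiv_eq (1, 0)).trans (by simp)
  rw [e1] at h1
  rw [e2] at h2
  have hs : fderiv ℝ (partialV (conormal X)) q (1, 0) = fderiv ℝ (partialU (conormal X)) q (0, 1) :=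
    partialU_partialV hν
  rw [hs] at h2
  unfold partialU partialV at *
  linarith

/-- The third form is `-D⁻³` times the second form composed with `A`. Taking minors against the
second form cancels one factor `D`, leaving exactly the denominator `D²`. -/
theorem hessDet_sq_mul_curvatureLineForm (hO : IsOpen O) (hX : ∀ q ∈ O, ContDiffAt ℝ ∞ X q)
    (hρ : ∀ q ∈ O, rho X k q ≠ 0) (hq : q ∈ O) (hD : hessDet X q ≠ 0) (w : Plane) :
    hessDet X q ^ 2 * curvatureLineForm X q w = -det2 (shapePencil X k q w) w := by
  have hl : thirdL X q = _ := thirdForm_eq hO hX hρ hq hD (1, 0) (1, 0)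
  have hm : thirdM X q = _ := thirdForm_eq hO hX hρ hq hD (1, 0) (0, 1)
  have hm' : thirdM X q = _ := (thirdForm_symm hO hX hρ hq hD).trans
    (thirdForm_eq hO hX hρ hq hD (0, 1) (1, 0))
  have hn : thirdN X q = _ := thirdForm_eq hO hX hρ hq hD (0, 1) (0, 1)
  rw [curvatureLineForm, clm_apply_eq (shapePencil X k q) w]
  set A := shapePencil X k q
  set l := thirdL X q
  set m := thirdM X q
  set n := thirdN X q
  set L := coeffL X q
  set M := coeffM X q
  set N := coeffN X q
  set D := hessDet X q with hDdef
  have hDe : D = L * N - M ^ 2 := rfl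
  have h1 : D ^ 2 * (l * M - m * L) = (A (1, 0)).2 := by
    rw [hl, hm']
    field_simp
    rw [hDe]
    ring
  have h2 : D ^ 2 * (m * N - n * M) = -(A (0, 1)).1 := by
    rw [hn, hm]
    field_simp
    rw [hDe]
    ring
  have h3 : D ^ 2 * (l * N - n * L) = (A (0, 1)).2 - (A (1, 0)).1 := by
    -- The two copies of `m M` are expanded differently, one with `⟨ν_u, ξ_v⟩` and one with `⟨ν_v,
    -- ξ_u⟩`, so that a factor `D` splits off.
    have h4 : D ^ 2 * (l * N - n * L + m * M - m * M) = (A (0, 1)).2 - (A (1, 0)).1 := by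
      nth_rewrite 1 [hm]
      rw [hl, hm', hn]
      field_simp
      rw [hDe]
      ring
    rw [← h4]
    ring
  simp only [det2, Prod.fst_add, Prod.snd_add, Prod.smul_fst, Prod.smul_snd, smul_eq_mul]
  linear_combination w.1 ^ 2 * h1 + w.1 * w.2 * h3 + w.2 ^ 2 * h2

theorem exists_smul_eq_of_det2_eq_zero {x w : Plane} (hw : w ≠ 0) (h : det2 x w = 0) :
    ∃ c : ℝ, x = c • w := by
  unfold det2 at h
  by_cases h1 : w.1 = 0
  · have h2 : w.2 ≠ 0 := fun h2 => hw (Prod.ext h1 h2)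
    refine ⟨x.2 / w.2, Prod.ext ?_ ?_⟩
    · simp only [Prod.smul_fst, smul_eq_mul]
      field_simp
      linarith
    · simp [h2]
  · refine ⟨x.1 / w.1, Prod.ext ?_ ?_⟩
    · simp [h1]
    · simp only [Prod.smul_snd, smul_eq_mul]
      field_simp
      linarith

theorem fderiv_injective_of_rho_ne_zero (hρ : rho X k q ≠ 0) {w : Plane}
    (hw : fderiv ℝ X q w = 0) : w = 0 := by
  rw [fderiv_eq_partials] at hw
  have h1 : det3 (w.1 • partialU X q + w.2 • partialV X q) (partialV X q) k = 0 := by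
    rw [hw]; simp [det3_eq]
  have h2 : det3 (partialU X q) (w.1 • partialU X q + w.2 • partialV X q) k = 0 := by
    rw [hw]; simp [det3_eq]
  ext
  · refine (mul_eq_zero.mp (h1 ▸ ?_ : w.1 * rho X k q = 0)).resolve_right hρ
    simp only [rho, det3_eq, Pi.add_apply, Pi.smul_apply, smul_eq_mul]
    ring
  · refine (mul_eq_zero.mp (h2 ▸ ?_ : w.2 * rho X k q = 0)).resolve_right hρ
    simp only [rho, det3_eq, Pi.add_apply, Pi.smul_apply, smul_eq_mul]
    ring

/-- Off the parabolic set `dξ` is a nonzero multiple of `dX ∘ A` and `dX` is injective, so the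
condition says that `w` is an eigenvector of `A`. On the parabolic set the limit is computed by
continuity of `A`. -/
theorem isAffinePrincipalDirection_iff (hO : IsOpen O) (hX : ∀ q ∈ O, ContDiffAt ℝ ∞ X q)
    (hρ : ∀ q ∈ O, rho X k q ≠ 0) (hq : q ∈ O) (hdD : fderiv ℝ (hessDet X) q ≠ 0) {w : Plane}
    (hw : w ≠ 0) : IsAffinePrincipalDirection X q w ↔ det2 (shapePencil X k q w) w = 0 := by
  by_cases hD : hessDet X q = 0
  · have hlim : Tendsto (fun q' => hessDet X q' ^ 2 * curvatureLineForm X q' w)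
        (𝓝[{q' | hessDet X q' ≠ 0}] q) (𝓝 (-det2 (shapePencil X k q w) w)) := by
      have hA := (contDiffAt_shapePencil (hX q hq) (hρ q hq)).continuousAt
      have hAw : ContinuousAt (fun x => shapePencil X k x w) q := hA.clm_apply continuousAt_const
      have hc : ContinuousAt (fun x => -det2 (shapePencil X k x w) w) q :=
        ((hAw.fst.mul continuousAt_const).sub (hAw.snd.mul continuousAt_const)).neg
      refine (hc.tendsto.mono_left nhdsWithin_le_nhds).congr' ?_
      filter_upwards [self_mem_nhdsWithin, mem_nhdsWithin_of_mem_nhds (hO.mem_nhds hq)] with x hx hxO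
      exact (hessDet_sq_mul_curvatureLineForm hO hX hρ hxO hx w).symm
    -- The limit determines its value only if nonparabolic points accumulate at `q`. Otherwise `D`
    -- would vanish near `q`, against `dD ≠ 0`.
    have hne : (𝓝[{q' | hessDet X q' ≠ 0}] q).NeBot := by
      rw [← mem_closure_iff_nhdsWithin_neBot, mem_closure_iff_frequently]
      intro hev
      apply hdD
      have : hessDet X =ᶠ[𝓝 q] fun _ => 0 := hev.mono fun x hx => not_not.mp hx
      rw [this.fderiv_eq]
      simp
    constructor
    · rintro ⟨-, ⟨h, -⟩ | ⟨-, h⟩⟩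
      · exact absurd hD h
      · simpa using tendsto_nhds_unique hlim h
    · intro h
      refine ⟨hw, Or.inr ⟨hD, ?_⟩⟩
      simpa [h] using hlim
  · have hs : |hessDet X q| ^ (1 / 4 : ℝ) / hessDet X q ^ 3 ≠ 0 :=
      div_ne_zero (Real.rpow_pos_of_pos (abs_pos.mpr hD) _).ne' (pow_ne_zero 3 hD)
    set s := |hessDet X q| ^ (1 / 4 : ℝ) / hessDet X q ^ 3 with hsdef
    have hξ := fderiv_affineNormal hO hX hρ hq hD w
    constructor
    · rintro ⟨-, ⟨-, lam, h⟩ | ⟨h, -⟩⟩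
      · rw [hξ, ← map_smul (fderiv ℝ X q), ← map_smul (fderiv ℝ X q),
          ← map_add (fderiv ℝ X q)] at h
        have h0 := fderiv_injective_of_rho_ne_zero (hρ q hq) h
        have h1 : s * (shapePencil X k q w).1 + lam * w.1 = 0 := congrArg Prod.fst h0
        have h2 : s * (shapePencil X k q w).2 + lam * w.2 = 0 := congrArg Prod.snd h0
        refine (mul_eq_zero.mp (?_ : s * det2 _ w = 0)).resolve_left hs
        unfold det2
        linear_combination w.2 * h1 - w.1 * h2
      · exact absurd h hD
    · intro h
      obtain ⟨c, hc⟩ := exists_smul_eq_of_det2_eq_zero hw h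
      refine ⟨hw, Or.inl ⟨hD, -(s * c), ?_⟩⟩
      rw [hξ, hc, map_smul, smul_smul, neg_smul, add_neg_cancel]

end Normal

/-! ### Ordinary parabolic points: the principal frame and the normal form -/

/-- A null vector `w` of a degenerate form lies in its kernel, so the adjugate is a multiple of `w
wᵀ`. Its value at `(x, y)` is then that multiple of `(x w₁ + y w₂)²`. -/
theorem adjugate_form_ne_zero {L M N x y w₁ w₂ : ℝ} (hdet : L * N - M ^ 2 = 0)
    (hw : L * w₁ ^ 2 + 2 * M * (w₁ * w₂) + N * w₂ ^ 2 = 0) (hs : x * w₁ + y * w₂ ≠ 0)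
    (hne : ¬(L = 0 ∧ M = 0 ∧ N = 0)) : N * x ^ 2 - 2 * M * (x * y) + L * y ^ 2 ≠ 0 := by
  intro hQ
  have h1 : L * w₁ + M * w₂ = 0 := by
    apply pow_eq_zero_iff (two_ne_zero) |>.mp
    linear_combination L * hw - w₂ ^ 2 * hdet
  have h2 : M * w₁ + N * w₂ = 0 := by
    apply pow_eq_zero_iff (two_ne_zero) |>.mp
    linear_combination N * hw - w₁ ^ 2 * hdet
  have hN : N = 0 := by
    refine (mul_eq_zero.mp (?_ : N * (x * w₁ + y * w₂) ^ 2 = 0)).resolve_right (pow_ne_zero 2 hs)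
    linear_combination w₁ ^ 2 * hQ + (2 * x * y * w₁ + y ^ 2 * w₂) * h2 - y ^ 2 * w₁ * h1
  have hL : L = 0 := by
    refine (mul_eq_zero.mp (?_ : L * (x * w₁ + y * w₂) ^ 2 = 0)).resolve_right (pow_ne_zero 2 hs)
    linear_combination w₂ ^ 2 * hQ + (2 * x * y * w₂ + x ^ 2 * w₁) * h1 - x ^ 2 * w₂ * h2
  have hM : M = 0 := by
    apply pow_eq_zero_iff (two_ne_zero) |>.mp
    linear_combination N * hL - hdet
  exact hne ⟨hL, hM, hN⟩

/-- At `p` one has `tauForm = dD / 4`, so the quantity is `7/16` times the adjugate of the second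
form evaluated on the components of `dD`. -/
theorem fderiv_hessDet_normalField_ne_zero {X : Plane → Space} {p : Plane} (k : Space)
    (hX : ContDiffAt ℝ ∞ X p) (hp : IsOrdinaryParabolicPoint X p) :
    fderiv ℝ (hessDet X) p ((-7 / 4 : ℝ) • normalField X k p) ≠ 0 := by
  obtain ⟨-, hD, w, hw, hdw⟩ := hp
  -- `D` is quadratic in `L, M, N`, so a vanishing second form would force `dD = 0` at `p`.
  have hne : ¬(coeffL X p = 0 ∧ coeffM X p = 0 ∧ coeffN X p = 0) := by
    rintro ⟨hL, hM, hN⟩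
    apply hdw
    have h1 := ((contDiffAt_coeffL hX).differentiableAt (by simp)).hasFDerivAt.fun_mul
      ((contDiffAt_coeffN hX).differentiableAt (by simp)).hasFDerivAt
    have h2 := ((contDiffAt_coeffM hX).differentiableAt (by simp)).hasFDerivAt.pow 2
    have h3 : HasFDerivAt (hessDet X) _ p := h1.fun_sub h2
    rw [h3.fderiv, hL, hM, hN]
    simp
  have hs : fderiv ℝ (hessDet X) p (1, 0) * w.1 + fderiv ℝ (hessDet X) p (0, 1) * w.2 ≠ 0 := by
    rw [clm_apply_eq (fderiv ℝ (hessDet X) p) w] at hdw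
    simp only [smul_eq_mul] at hdw
    rwa [mul_comm _ w.1, mul_comm _ w.2]
  have hQ := adjugate_form_ne_zero hD hw hs hne
  rw [clm_apply_eq (fderiv ℝ (hessDet X) p)]
  have hτ : ∀ v, tauForm X k p v = 1 / 4 * fderiv ℝ (hessDet X) p v := by
    intro v
    simp [tauForm, hD]
  simp only [normalField, hτ, smul_eq_mul, Prod.smul_mk]
  intro h0
  apply hQ
  linear_combination (16 / 7 : ℝ) * h0

theorem exists_principal_frame {X : Plane → Space} {U : Set Plane} (hU : IsOpen U)
    (hX : ContDiffOn ℝ ∞ X U) {p : Plane} (hpU : p ∈ U) (hp : IsOrdinaryParabolicPoint X p) :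
    ∃ (e f : Plane → Plane) (κ : Plane → ℝ),
      (∀ᶠ q in 𝓝 p, ContDiffAt ℝ ∞ e q ∧ ContDiffAt ℝ ∞ f q) ∧
      ContinuousAt κ p ∧ fderiv ℝ (hessDet X) p (e p) ≠ 0 ∧
      (∀ᶠ q in 𝓝 p, fderiv ℝ (hessDet X) q (f q) = κ q * hessDet X q) ∧
      ∀ᶠ q in 𝓝 p, IsTransversalPair (IsAffinePrincipalDirection X) q (e q) (f q) := by
  have hXU : ∀ q ∈ U, ContDiffAt ℝ ∞ X q := fun q hq => hX.contDiffAt (hU.mem_nhds hq)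
  -- The Euclidean normal direction at `p`, frozen: it remains transversal to the surface near `p`.
  set k : Space := crossProduct (partialU X p) (partialV X p)
  have hρp : rho X k p ≠ 0 := det3_self_cross_ne_zero hp.1
  have hXp := hXU p hpU
  have hρ_ev : ∀ᶠ q in 𝓝 p, rho X k q ≠ 0 := (contDiffAt_rho hXp).continuousAt.eventually_ne hρp
  obtain ⟨O, hOs, hO, hpO⟩ := eventually_nhds_iff.mp (hρ_ev.and (hU.mem_nhds hpU))
  have hXρ_ev : ∀ᶠ q in 𝓝 p, ContDiffAt ℝ ∞ X q ∧ rho X k q ≠ 0 := by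
    filter_upwards [hO.mem_nhds hpO] with q hq using ⟨hXU q (hOs q hq).2, (hOs q hq).1⟩
  obtain ⟨e, f, κ, hefC, hκ, hDe, hDf, hef⟩ := exists_eigenfields_pencil
    (hXρ_ev.mono fun q hq => contDiffAt_hessDet hq.1)
    (hXρ_ev.mono fun q hq => contDiffAt_covariantDeriv hq.1 hq.2)
    (hXρ_ev.mono fun q hq => (contDiffAt_normalField hq.1 hq.2).const_smul (-7 / 4 : ℝ)) hp.2.1
    (fderiv_hessDet_normalField_ne_zero k hXp hp)
  have hdDp : fderiv ℝ (hessDet X) p ≠ 0 := fun h0 => hDe (by rw [h0]; rfl)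
  have hdD_ev : ∀ᶠ q in 𝓝 p, fderiv ℝ (hessDet X) q ≠ 0 :=
    ((contDiffAt_hessDet hXp).continuousAt_fderiv (by simp)).eventually_ne hdDp
  refine ⟨e, f, κ, hefC, hκ, hDe, hDf, ?_⟩
  filter_upwards [hef, hdD_ev, hO.mem_nhds hpO] with q hq hdq hqO
  refine ⟨hq.1, fun w hw => ?_⟩
  rw [isAffinePrincipalDirection_iff hO (fun x hx => hXU x (hOs x hx).2)
    (fun x hx => (hOs x hx).1) hqO hdq hw]
  exact hq.2 w

theorem affineConfiguration_locallyTopEquivalent_normalForm {X : Plane → Space} {U : Set Plane}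
    (hU : IsOpen U) (hX : ContDiffOn ℝ ∞ X U) {p : Plane} (hpU : p ∈ U)
    (hp : IsOrdinaryParabolicPoint X p) :
    LocallyTopEquivalent (affineConfiguration X) p normalForm 0 := by
  obtain ⟨e, f, κ, hefC, hκ, hDe, hDf, hef⟩ := exists_principal_frame hU hX hpU hp
  have hXp : ContDiffAt ℝ ∞ X p := hX.contDiffAt (hU.mem_nhds hpU)
  have h1 : (1 : WithTop ℕ∞) ≤ ∞ := by simp
  refine locallyTopEquivalent_normalForm (hefC.self_of_nhds.1.of_le h1)
    (hefC.self_of_nhds.2.of_le h1)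
    ((contDiffAt_hessDet hXp).of_le h1) hκ hp.2.1 hDe hDf hef ?_
  filter_upwards [hef] with q hq
  -- Two transversal principal directions exist at every nearby point, so only the parabolic set is
  -- singular.
  exact or_iff_left (not_not.mpr ⟨e q, f q, hq⟩)

/-! ### Equivalence of configurations and dependence on the jet -/

theorem LocallyTopEquivalent.symm {F G : Configuration} {p p' : Plane}
    (h : LocallyTopEquivalent F p G p') : LocallyTopEquivalent G p' F p := by
  obtain ⟨φ, hp, rfl, hC, hs⟩ := h
  refine ⟨φ.symm, φ.map_source hp, φ.left_inv hp, fun C hCs => ?_, fun q hq => ?_⟩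
  · have h1 : φ.symm '' C ⊆ φ.source := by
      rintro _ ⟨x, hx, rfl⟩
      exact φ.map_target (hCs hx)
    have h2 : φ '' (φ.symm '' C) = C := φ.toPartialEquiv.image_symm_image_of_subset_target hCs
    rw [hC _ h1, h2]
  · rw [hs _ (φ.map_target hq), φ.right_inv hq]

theorem LocallyTopEquivalent.trans {F G H : Configuration} {p p' p'' : Plane}
    (h : LocallyTopEquivalent F p G p') (h' : LocallyTopEquivalent G p' H p'') :
    LocallyTopEquivalent F p H p'' := by
  obtain ⟨φ, hp, rfl, hC, hs⟩ := h
  obtain ⟨ψ, hp', rfl, hC', hs'⟩ := h'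
  refine ⟨φ.trans ψ, ?_, rfl, fun C hCs => ?_, fun q hq => ?_⟩
  · rw [OpenPartialHomeomorph.trans_source]
    exact ⟨hp, hp'⟩
  · rw [OpenPartialHomeomorph.trans_source] at hCs
    rw [hC C fun x hx => (hCs hx).1, hC' (φ '' C) (by rintro _ ⟨x, hx, rfl⟩; exact (hCs hx).2),
      ← image_comp]
    rfl
  · rw [OpenPartialHomeomorph.trans_source] at hq
    rw [hs q hq.1, hs' _ hq.2]
    rfl

section Jets

variable {X Y : Plane → Space} {p : Plane}

/-- `f` and `g` have the same value and the same derivative at `p`. -/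
def SameOneJet {E : Type*} [NormedAddCommGroup E] [NormedSpace ℝ E] (f g : Plane → E) (p : Plane) :
    Prop :=
  f p = g p ∧ fderiv ℝ f p = fderiv ℝ g p

theorem fderiv_eq_iteratedFDeriv_one (f : Plane → Space) (p w : Plane) :
    fderiv ℝ f p w = iteratedFDeriv ℝ 1 f p (fun _ => w) := by
  rw [iteratedFDeriv_one_apply]

theorem fderiv_fderiv_apply_eq {Z : Plane → Space} (hZ : ContDiffAt ℝ ∞ Z p) (v w : Plane) :
    fderiv ℝ (fun x => fderiv ℝ Z x v) p w = iteratedFDeriv ℝ 2 Z p ![w, v] := by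
  rw [fderiv_fderiv_apply hZ, iteratedFDeriv_two_apply]
  rfl

theorem fderiv_fderiv_fderiv_apply_eq {Z : Plane → Space} (hZ : ContDiffAt ℝ ∞ Z p) (u v w : Plane)
    (hZ' : ∀ᶠ q in 𝓝 p, ContDiffAt ℝ ∞ Z q) :
    fderiv ℝ (fun x => fderiv ℝ (fun y => fderiv ℝ Z y u) x v) p w =
      iteratedFDeriv ℝ 3 Z p ![w, v, u] := by
  have h1 : (fun x => fderiv ℝ (fun y => fderiv ℝ Z y u) x v) =ᶠ[𝓝 p]
      fun x => iteratedFDeriv ℝ 2 Z x ![v, u] :=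
    hZ'.mono fun q hq => fderiv_fderiv_apply_eq hq u v
  rw [h1.fderiv_eq, iteratedFDeriv_succ_apply_left]
  have h2 : DifferentiableAt ℝ (iteratedFDeriv ℝ 2 Z) p :=
    hZ.differentiableAt_iteratedFDeriv (by exact WithTop.coe_lt_coe.mpr (ENat.natCast_lt_top 2))
  have h3 : HasFDerivAt (fun x => iteratedFDeriv ℝ 2 Z x ![v, u]) _ p :=
    (ContinuousMultilinearMap.apply ℝ (fun _ : Fin 2 => Plane) Space ![v, u]).hasFDerivAt.comp p
      h2.hasFDerivAt
  rw [h3.fderiv]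
  rfl

theorem SameJet.sameOneJets (hX : ∀ᶠ q in 𝓝 p, ContDiffAt ℝ ∞ X q)
    (hY : ∀ᶠ q in 𝓝 p, ContDiffAt ℝ ∞ Y q) (h : SameJet 4 X Y p) :
    SameOneJet (partialU X) (partialU Y) p ∧ SameOneJet (partialV X) (partialV Y) p ∧
      ∀ v w : Plane, SameOneJet (fun x => fderiv ℝ (fun y => fderiv ℝ X y v) x w)
        (fun x => fderiv ℝ (fun y => fderiv ℝ Y y v) x w) p := by
  have hX0 := hX.self_of_nhds
  have hY0 := hY.self_of_nhds
  have h1 : ∀ w, fderiv ℝ X p w = fderiv ℝ Y p w := fun w => by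
    rw [fderiv_eq_iteratedFDeriv_one, fderiv_eq_iteratedFDeriv_one, h 1 (by norm_num)]
  have h2 : ∀ v w, fderiv ℝ (fun x => fderiv ℝ X x v) p w = fderiv ℝ (fun x => fderiv ℝ Y x v) p w :=
    fun v w => by
      rw [fderiv_fderiv_apply_eq hX0, fderiv_fderiv_apply_eq hY0, h 2 (by norm_num)]
  refine ⟨⟨h1 _, ContinuousLinearMap.ext fun w => h2 _ w⟩,
    ⟨h1 _, ContinuousLinearMap.ext fun w => h2 _ w⟩, fun v w => ⟨h2 v w, ?_⟩⟩
  refine ContinuousLinearMap.ext fun u => ?_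
  rw [fderiv_fderiv_fderiv_apply_eq hX0 v w u hX, fderiv_fderiv_fderiv_apply_eq hY0 v w u hY,
    h 3 (by norm_num)]

theorem SameOneJet.comp {E F : Type*} [NormedAddCommGroup E] [NormedSpace ℝ E]
    [NormedAddCommGroup F] [NormedSpace ℝ F] {f g : Plane → E} (h : SameOneJet f g p)
    {P : E → F} (hP : Differentiable ℝ P) (hf : DifferentiableAt ℝ f p)
    (hg : DifferentiableAt ℝ g p) : SameOneJet (fun x => P (f x)) (fun x => P (g x)) p := by
  refine ⟨congrArg P h.1, ?_⟩
  rw [fderiv_fun_comp p (hP _) hf, fderiv_fun_comp p (hP _) hg, h.1, h.2]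

theorem SameOneJet.prodMk {E F : Type*} [NormedAddCommGroup E] [NormedSpace ℝ E]
    [NormedAddCommGroup F] [NormedSpace ℝ F] {f g : Plane → E} {f' g' : Plane → F}
    (h : SameOneJet f g p) (h' : SameOneJet f' g' p) (hf : DifferentiableAt ℝ f p)
    (hg : DifferentiableAt ℝ g p) (hf' : DifferentiableAt ℝ f' p) (hg' : DifferentiableAt ℝ g' p) :
    SameOneJet (fun x => (f x, f' x)) (fun x => (g x, g' x)) p := by
  refine ⟨Prod.ext h.1 h'.1, ?_⟩
  rw [hf.fderiv_prodMk hf', hg.fderiv_prodMk hg', h.2, h'.2]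

theorem differentiable_det3 : Differentiable ℝ fun x : Space × Space × Space => det3 x.1 x.2.1 x.2.2 := by
  simp only [det3_eq]
  fun_prop

theorem SameOneJet.det3 {a b c a' b' c' : Plane → Space} (h₁ : SameOneJet a a' p)
    (h₂ : SameOneJet b b' p) (h₃ : SameOneJet c c' p) (ha : DifferentiableAt ℝ a p)
    (hb : DifferentiableAt ℝ b p) (hc : DifferentiableAt ℝ c p) (ha' : DifferentiableAt ℝ a' p)
    (hb' : DifferentiableAt ℝ b' p) (hc' : DifferentiableAt ℝ c' p) :
    SameOneJet (fun x => AffSurf.det3 (a x) (b x) (c x))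
      (fun x => AffSurf.det3 (a' x) (b' x) (c' x)) p :=
  (h₁.prodMk (h₂.prodMk h₃ hb hb' hc hc') ha ha' (hb.prodMk hc) (hb'.prodMk hc')).comp
    differentiable_det3 (ha.prodMk (hb.prodMk hc)) (ha'.prodMk (hb'.prodMk hc'))

/-- The condition involves only `X_u`, `X_v`, the values of `L, M, N` and the 1-jet of `D` at `p`,
hence derivatives of `X` of order at most three. -/
theorem IsOrdinaryParabolicPoint.of_sameJet (hX : ∀ᶠ q in 𝓝 p, ContDiffAt ℝ ∞ X q)
    (hY : ∀ᶠ q in 𝓝 p, ContDiffAt ℝ ∞ Y q) (h : SameJet 4 X Y p)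
    (hp : IsOrdinaryParabolicPoint X p) : IsOrdinaryParabolicPoint Y p := by
  obtain ⟨hU, hV, hW⟩ := h.sameOneJets hX hY
  have hX0 := hX.self_of_nhds
  have hY0 := hY.self_of_nhds
  have hdiff : ∀ {Z : Plane → Space}, ContDiffAt ℝ ∞ Z p → DifferentiableAt ℝ Z p :=
    fun hZ => hZ.differentiableAt (by simp)
  have hL : SameOneJet (coeffL X) (coeffL Y) p := hU.det3 hV (hW (1, 0) (1, 0))
    (hdiff (contDiffAt_partialU hX0)) (hdiff (contDiffAt_partialV hX0))
    (hdiff (contDiffAt_partialU (contDiffAt_partialU hX0)))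
    (hdiff (contDiffAt_partialU hY0)) (hdiff (contDiffAt_partialV hY0))
    (hdiff (contDiffAt_partialU (contDiffAt_partialU hY0)))
  have hM : SameOneJet (coeffM X) (coeffM Y) p := hU.det3 hV (hW (1, 0) (0, 1))
    (hdiff (contDiffAt_partialU hX0)) (hdiff (contDiffAt_partialV hX0))
    (hdiff (contDiffAt_partialV (contDiffAt_partialU hX0)))
    (hdiff (contDiffAt_partialU hY0)) (hdiff (contDiffAt_partialV hY0))
    (hdiff (contDiffAt_partialV (contDiffAt_partialU hY0)))
  have hN : SameOneJet (coeffN X) (coeffN Y) p := hU.det3 hV (hW (0, 1) (0, 1))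
    (hdiff (contDiffAt_partialU hX0)) (hdiff (contDiffAt_partialV hX0))
    (hdiff (contDiffAt_partialV (contDiffAt_partialV hX0)))
    (hdiff (contDiffAt_partialU hY0)) (hdiff (contDiffAt_partialV hY0))
    (hdiff (contDiffAt_partialV (contDiffAt_partialV hY0)))
  have hLX := (contDiffAt_coeffL hX0).differentiableAt (by simp)
  have hMX := (contDiffAt_coeffM hX0).differentiableAt (by simp)
  have hNX := (contDiffAt_coeffN hX0).differentiableAt (by simp)
  have hLY := (contDiffAt_coeffL hY0).differentiableAt (by simp)
  have hMY := (contDiffAt_coeffM hY0).differentiableAt (by simp)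
  have hNY := (contDiffAt_coeffN hY0).differentiableAt (by simp)
  have hD : SameOneJet (hessDet X) (hessDet Y) p :=
    (hL.prodMk (hM.prodMk hN hMX hMY hNX hNY) hLX hLY (hMX.prodMk hNX) (hMY.prodMk hNY)).comp
      (P := fun x : ℝ × ℝ × ℝ => x.1 * x.2.2 - x.2.1 ^ 2) (by fun_prop)
      (hLX.prodMk (hMX.prodMk hNX)) (hLY.prodMk (hMY.prodMk hNY))
  rw [IsOrdinaryParabolicPoint, ← hU.1, ← hV.1, ← hL.1, ← hM.1, ← hN.1, ← hD.1, ← hD.2]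
  exact hp

end Jets

end AffSurf

end

theorem mainTheorem6 (X : AffSurf.Plane → AffSurf.Space) (U : Set AffSurf.Plane) (hU : IsOpen U)
    (hX : ContDiffOn ℝ ∞ X U) (p : AffSurf.Plane) (hpU : p ∈ U)
    (hp : AffSurf.IsOrdinaryParabolicPoint X p) :
    (∃ (V : Set AffSurf.Plane) (e f : AffSurf.Plane → AffSurf.Plane),
      IsOpen V ∧ p ∈ V ∧ V ⊆ U ∧ ContDiffOn ℝ ∞ e V ∧ ContDiffOn ℝ ∞ f V ∧
      ∀ q ∈ V, AffSurf.IsTransversalPair (AffSurf.IsAffinePrincipalDirection X) q (e q) (f q)) ∧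
    AffSurf.LocallyTopEquivalent (AffSurf.affineConfiguration X) p AffSurf.normalForm 0 ∧
    ∀ (Y : AffSurf.Plane → AffSurf.Space) (W : Set AffSurf.Plane), IsOpen W → p ∈ W →
      ContDiffOn ℝ ∞ Y W → AffSurf.SameJet 4 X Y p →
      AffSurf.LocallyTopEquivalent (AffSurf.affineConfiguration X) p
        (AffSurf.affineConfiguration Y) p := by
  have hequiv := AffSurf.affineConfiguration_locallyTopEquivalent_normalForm hU hX hpU hp
  refine ⟨?_, hequiv, fun Y W hW hpW hY hXY => ?_⟩
  · obtain ⟨e, f, -, hefC, -, -, -, hef⟩ := AffSurf.exists_principal_frame hU hX hpU hp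
    obtain ⟨V, hV, hVo, hpV⟩ :=
      eventually_nhds_iff.mp ((hefC.and hef).and (hU.eventually_mem hpU))
    exact ⟨V, e, f, hVo, hpV, fun q hq => (hV q hq).2,
      fun q hq => (hV q hq).1.1.1.contDiffWithinAt, fun q hq => (hV q hq).1.1.2.contDiffWithinAt,
      fun q hq => (hV q hq).1.2⟩
  -- Both configurations are equivalent to `v du dv = 0`; the equivalence between them passes
  -- through this common normal form.
  · refine hequiv.trans (AffSurf.LocallyTopEquivalent.symm ?_)
    refine AffSurf.affineConfiguration_locallyTopEquivalent_normalForm hW hY hpW ?_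
    exact hp.of_sameJet ((hU.eventually_mem hpU).mono fun q hq => hX.contDiffAt (hU.mem_nhds hq))
      ((hW.eventually_mem hpW).mono fun q hq => hY.contDiffAt (hW.mem_nhds hq)) hXY
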